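/- Let $(\Omega,P)$ be a probability space. For each $N\ge 1$ let $a_N$ be a real random variable, $b_N$ a random vector in $\mathbb{C}^N$ and $C_N$ a random Hermitian $N\times N$ complex matrix, all defined on $\Omega$, and put $$X_N=\begin{bmatrix} a_N & -b_N^*\\ b_N & C_N\end{bmatrix},\qquad H_N=\begin{bmatrix}-1&0\\0&I_N\end{bmatrix},$$ so that $X_N$ is $H_N$-selfadjoint, i.e. $X_N^*H_N=H_NX_N$. Let $\nu_N=\frac1N\sum_{j=1}^N\delta_{\lambda_j^N}$, where $\lambda_1^N\le\dots\le\lambda_N^N$ are the eigenvalues of $C_N$ counted with multiplicity. Assume: (R0) for each $N$, $a_N$ is independent of $b_N$ and of the (entries of the) matrix $C_N$, and $a_N\to0$ in probability as $N\to\infty$; (R1) $b_N=\frac1{\sqrt N}(x_1,\dots,x_N)^\top$, where $x_1,x_2,\dots$ are i.i.d. complex random variables with $E|x_j|^2=s^2<\infty$ and $E x_j=0$ and, for each $N$, the vector $(x_1,\dots,x_N)$ is independent of the (entries of the) matrix $C_N$; (R2) $\nu_N$ converges weakly in probability to a non-random finite Borel measure $\mu_0$ on $\mathbb{R}$, i.e.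 $\int f\,d\nu_N\to\int f\,d\mu_0$ in probability for every bounded continuous $f:\mathbb{R}\to\mathbb{R}$. Then the following hold. 1. For every $N$ (and every realization) there is exactly one $\beta_N\in\mathbb{C}$ with $\operatorname{Im}\beta_N\ge0$ such that $X_Nx=\beta_Nx$ for some $x\in\mathbb{C}^{N+1}\setminus\{0\}$ with $x^*H_Nx\le0$; it is called the eigenvalue of nonpositive type of $X_N$. 2. Let $Q_0(z)=-z+s^2\hat\mu_0(z)$, where $\hat\mu_0(z)=\int_{\mathbb{R}}\frac{d\mu_0(t)}{t-z}$. There is exactly one $\beta_0\in\mathbb{C}$ such that either $\operatorname{Im}\beta_0>0$ and $Q_0(\beta_0)=0$, or $\beta_0\in\mathbb{R}$ and the limit of $\frac{Q_0(z)}{z-\beta_0}$ as $z\to\beta_0$ non-tangentially from the upper half-plane (that is, within each sector $\pi/2-\theta\le\arg(z-\beta_0)\le\pi/2+\theta$, $0<\theta<\pi/2$) exists and belongs to $(-\infty,0]$; it is called the generalized zero of nonpositive type (GZNT) of $Q_0$. 3. $\beta_N$ converges to $\beta_0$ in probability as $N\to\infty$. -/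

import Mathlib

open MeasureTheory ProbabilityTheory Filter Topology

namespace HSelfadjoint

/-- The matrix `H = diag(-1, I_N)`. The index `Sum.inl ()` is the distinguished first coordinate. -/
def signMatrix (N : ℕ) : Matrix (Unit ⊕ Fin N) (Unit ⊕ Fin N) ℂ :=
  Matrix.fromBlocks (-1) 0 0 1

/-- The matrix `X = [[a, -b^*], [b, C]]`. -/
def blockMatrix {N : ℕ} (a : ℝ) (b : Fin N → ℂ) (C : Matrix (Fin N) (Fin N) ℂ) :
    Matrix (Unit ⊕ Fin N) (Unit ⊕ Fin N) ℂ :=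
  Matrix.fromBlocks (Matrix.of fun _ _ => (a : ℂ)) (-(Matrix.replicateCol Unit b).conjTranspose)
    (Matrix.replicateCol Unit b) C

/-- `X` is selfadjoint with respect to `[x, y]_H = y^* H x`. -/
def IsHSelfadjoint {n : Type*} [Fintype n] (H X : Matrix n n ℂ) : Prop :=
  X.conjTranspose * H = H * X

/-- The indefinite inner product `[x, y]_H = y^* H x`. -/
def form {n : Type*} [Fintype n] (H : Matrix n n ℂ) (x y : n → ℂ) : ℂ :=
  dotProduct (star y) (H.mulVec x)

/-- The block matrices of this shape, with `a` real and `C` Hermitian, are `H`-selfadjoint. -/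
theorem isHSelfadjoint_blockMatrix {N : ℕ} (a : ℝ) (b : Fin N → ℂ)
    (C : Matrix (Fin N) (Fin N) ℂ) (hC : C.IsHermitian) :
    IsHSelfadjoint (signMatrix N) (blockMatrix a b C) := by
  have h : (Matrix.of fun _ _ => (a : ℂ) : Matrix Unit Unit ℂ).conjTranspose
      = Matrix.of fun _ _ => (a : ℂ) := by
    ext i j; simp
  simp [IsHSelfadjoint, signMatrix, blockMatrix, Matrix.fromBlocks_conjTranspose,
    Matrix.fromBlocks_multiply, hC.eq, h]

/-- `β` is an eigenvalue of nonpositive type of `X` with respect to `H`: it lies in the closed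
upper half-plane and has an eigenvector `x` with `[x, x]_H ≤ 0`. (For Hermitian `H` the number
`[x, x]_H` is real.) -/
def IsEigenvalueOfNonposType {n : Type*} [Fintype n] (H X : Matrix n n ℂ) (β : ℂ) : Prop :=
  0 ≤ β.im ∧ ∃ x : n → ℂ, x ≠ 0 ∧ X.mulVec x = β • x ∧ (form H x x).re ≤ 0

/-- The eigenvalue distribution `(1/N) ∑ δ_{λ_j}` of a Hermitian matrix. -/
noncomputable def spectralMeasure {N : ℕ} {C : Matrix (Fin N) (Fin N) ℂ} (hC : C.IsHermitian) :
    Measure ℝ :=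
  (N : ENNReal)⁻¹ • ∑ j : Fin N, Measure.dirac (hC.eigenvalues j)

/-- The Stieltjes transform `∫ 1 / (t - z) dμ(t)`. -/
noncomputable def stieltjes (μ : Measure ℝ) (z : ℂ) : ℂ :=
  ∫ t : ℝ, 1 / ((t : ℂ) - z) ∂μ

/-- The sector `π/2 - θ ≤ arg (z - x) ≤ π/2 + θ` in the open upper half-plane with vertex `x`. -/
def sector (x θ : ℝ) : Set ℂ :=
  {z : ℂ | 0 < z.im ∧ Real.pi / 2 - θ ≤ (z - (x : ℂ)).arg ∧ (z - (x : ℂ)).arg ≤ Real.pi / 2 + θ}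

/-- Non-tangential convergence of `f` to `c` at the real point `x`, from the upper half-plane. -/
def NontangentialTendsto (f : ℂ → ℂ) (x : ℝ) (c : ℂ) : Prop :=
  ∀ θ : ℝ, 0 < θ → θ < Real.pi / 2 → Tendsto f (𝓝[sector x θ] (x : ℂ)) (𝓝 c)

/-- `z₀` is a (finite) generalized zero of nonpositive type of `Q`: either a zero in the open upper
half-plane, or a real point at which `Q(z) / (z - z₀)` has a non-tangential limit in `(-∞, 0]`. -/
def IsGZNT (Q : ℂ → ℂ) (z₀ : ℂ) : Prop :=
  (0 < z₀.im ∧ Q z₀ = 0) ∨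
    (∃ x : ℝ, z₀ = (x : ℂ) ∧
      ∃ c : ℝ, c ≤ 0 ∧ NontangentialTendsto (fun z => Q z / (z - (x : ℂ))) x (c : ℂ))

/-- The random measures `ν N` converge weakly in probability to the deterministic measure `μ`. -/
def TendstoWeaklyInProbability {Ω : Type*} [MeasurableSpace Ω] (P : Measure Ω)
    (ν : ℕ → Ω → Measure ℝ) (μ : Measure ℝ) : Prop :=
  ∀ f : BoundedContinuousFunction ℝ ℝ,
    TendstoInMeasure P (fun N ω => ∫ t, f t ∂(ν N ω)) atTop (fun _ => ∫ t, f t ∂μ)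

/-- The normalized column `b_N = N^{-1/2} (x_1, …, x_N)` (indexed from `0` here). -/
noncomputable def column {Ω : Type*} (x : ℕ → Ω → ℂ) (N : ℕ) (ω : Ω) : Fin N → ℂ :=
  fun j => ((1 / Real.sqrt N : ℝ) : ℂ) * x j ω

end HSelfadjoint

/-! Scale an eigenvector of nonpositive type to have first coordinate 1. Its tail u satisfies (C -
β)u = -b, β = a - b*u and |u| ≤ 1. Formally, β is then a fixed point of F_N(z) = a + b*(C - z)⁻¹b
with derivative at most 1 in absolute value, the analogue of a Denjoy–Wolff point. The rigorous form
is Julia's inequality |F_N(z) - β|² Im z ≤ |z - β|² Im F_N(z) for all z in the open upper half-plane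
(`IsEigenvalueOfNonposType.juliaInequality`). It evaluates F_N only at interior points, so it
survives pointwise limits of F_N even when β_N approaches the real line.

The limit of F_N(z) in probability is s²μ̂₀(z), the Stieltjes transform of σ = s²μ₀. Given C, the
quadratic form b*(C - z)⁻¹b concentrates around s² times the normalised trace of the resolvent
(`exists_integral_norm_quadraticForm_le`; second moments suffice, by truncation). That trace is the
Stieltjes transform of ν_N, and a_N tends to 0.

Compactness (`exists_finset_juliaInequality`) reduces Julia's inequality to finitely many z, so β_N
lies with high probability in any open set containing the Julia points of the limit. Such points are
GZNTs (`isGZNT_of_juliaInequality`). Every GZNT is a fixed point with ∫|t - β|⁻² dσ ≤ 1, and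
equality in Cauchy–Schwarz leaves at most one (`IsAttractingFixedPoint.unique`). Existence of β₀
also comes from the matrices: without a Julia point, β_N would lie in the empty set with probability
tending to 1.

For the matrices themselves, existence is indefinite linear algebra (`exists_eigenvector_nonpos`)
and uniqueness is again Cauchy–Schwarz, applied to tails. -/

namespace HSelfadjoint

/-! ### Selfadjoint operators in an indefinite inner product space -/

section Existence

variable {V : Type*} [AddCommGroup V] [Module ℂ V]

/-- Eigenvectors of a selfadjoint operator at eigenvalues which are not conjugate are orthogonal. -/
theorem selfadjoint_eigenvectors_orthogonal (B : V →ₗ⋆[ℂ] V →ₗ[ℂ] ℂ) (T : Module.End ℂ V)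
    (hT : ∀ x y, B (T x) y = B x (T y)) {l m : ℂ} {v w : V} (hv : T v = l • v) (hw : T w = m • w)
    (hlm : star l ≠ m) : B v w = 0 := by
  have h := hT v w
  rw [hv, hw] at h
  simp only [LinearMap.map_smulₛₗ, LinearMap.smul_apply, smul_eq_mul] at h
  have h' : (star l - m) * B v w = 0 := by
    rw [sub_mul]; exact sub_eq_zero.2 h
  exact (mul_eq_zero.1 h').resolve_left (sub_ne_zero.2 hlm)

/-- An operator which is selfadjoint for a nondegenerate Hermitian form that is not nonnegative has
an eigenvalue of nonpositive type in the closed upper half-plane. -/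
theorem exists_eigenvector_nonpos [FiniteDimensional ℂ V] (B : V →ₗ⋆[ℂ] V →ₗ[ℂ] ℂ)
    (hB : ∀ x, (∀ y, B y x = 0) → x = 0) (T : Module.End ℂ V)
    (hT : ∀ x y, B (T x) y = B x (T y)) (e : V) (he : (B e e).re < 0) :
    ∃ (l : ℂ) (v : V), 0 ≤ l.im ∧ v ≠ 0 ∧ T v = l • v ∧ (B v v).re ≤ 0 := by
  by_contra! hcon
  -- A nonreal eigenvalue has an isotropic eigenvector, which is excluded in the closed upper
  -- half-plane. If Im l < 0, the range of T - l̄ is orthogonal to v, so nondegeneracy and finite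
  -- dimension make l̄ an eigenvalue, in the upper half-plane.
  have hreal : ∀ (l : ℂ) (v : V), v ≠ 0 → T v = l • v → star l = l := by
    intro l v hv hl
    by_contra hne
    have hzero : B v v = 0 := selfadjoint_eigenvectors_orthogonal B T hT hl hl hne
    rcases le_or_gt 0 l.im with him | him
    · have := hcon l v him hv hl
      rw [hzero] at this
      simp at this
    · have hnsurj : ¬ Function.Surjective (T - star l • (1 : Module.End ℂ V)) := by
        intro hs
        apply hv
        apply hB
        intro y
        obtain ⟨x, rfl⟩ := hs y
        simp [hT, hl]
      have hninj : ¬ Function.Injective (T - star l • (1 : Module.End ℂ V)) :=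
        fun hi => hnsurj (LinearMap.injective_iff_surjective.1 hi)
      rw [← LinearMap.ker_eq_bot, Submodule.eq_bot_iff] at hninj
      push Not at hninj
      obtain ⟨w, hw, hw0⟩ := hninj
      have hw' : T w = star l • w := by
        simpa [sub_eq_zero] using hw
      have hz : B w w = 0 := selfadjoint_eigenvectors_orthogonal B T hT hw' hw' (by
        intro h; apply hne; rw [star_star] at h; exact h.symm)
      have := hcon (star l) w (by simpa using him.le) hw0 hw'
      rw [hz] at this
      simp at this
  have hpos : ∀ (l : ℂ) (v : V), v ≠ 0 → T v = l • v → 0 < (B v v).re := by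
    intro l v hv hl
    refine hcon l v ?_ hv hl
    have := congrArg Complex.im (hreal l v hv hl)
    simp at this
    linarith
  -- No Jordan chains: for real l, an eigenvector (T - l)v would satisfy [(T - l)v, (T - l)v] = [v,
  -- (T - l)²v] = 0, against positivity.
  have hsq : ∀ (l : ℂ) (v : V), T (T v - l • v) = l • (T v - l • v) → T v = l • v := by
    intro l v h
    by_contra hne
    have h0 : T v - l • v ≠ 0 := sub_ne_zero.2 hne
    have h1 := hpos l _ h0 h
    have h2 := hreal l _ h0 h
    have : B (T v - l • v) (T v - l • v) = 0 := by
      have h2' : (starRingEnd ℂ) l = l := h2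
      have e1 : B (T v) (T v - l • v) = l * B v (T v - l • v) := by
        rw [hT, h, LinearMap.map_smul, smul_eq_mul]
      have e2 : B (l • v) (T v - l • v) = l * B v (T v - l • v) := by
        simp only [LinearMap.map_smulₛₗ, LinearMap.smul_apply, h2', smul_eq_mul]
      rw [map_sub B, LinearMap.sub_apply, e1, e2, sub_self]
    rw [this] at h1
    simp at h1
  have hgen : ∀ (l : ℂ) (v : V), v ∈ T.maxGenEigenspace l → T v = l • v := by
    intro l v hv
    rw [Module.End.mem_maxGenEigenspace] at hv
    obtain ⟨k, hk⟩ := hv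
    induction k with
    | zero => simp at hk; simp [hk]
    | succ k ih =>
      rcases k with _ | k
      · simpa [sub_eq_zero] using hk
      · apply ih
        have := hsq l (((T - l • (1 : Module.End ℂ V)) ^ k) v) (by
          rw [pow_succ', pow_succ'] at hk
          simpa [sub_eq_zero] using hk)
        rw [pow_succ']
        simpa [sub_eq_zero] using this
  -- The space is now an orthogonal sum of eigenspaces on which the form is positive, so the
  -- negative vector `e` cannot exist.
  have htop := Module.End.iSup_maxGenEigenspace_eq_top T
  have hmem : e ∈ ⨆ l, T.maxGenEigenspace l := by rw [htop]; trivial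
  obtain ⟨f, hf, rfl⟩ := (Submodule.mem_iSup_iff_exists_finsupp _ _).1 hmem
  have hortho : ∀ l m, l ≠ m → B (f l) (f m) = 0 := by
    intro l m hlm
    by_cases h0 : f l = 0
    · simp [h0]
    refine selfadjoint_eigenvectors_orthogonal B T hT (hgen l _ (hf l)) (hgen m _ (hf m)) ?_
    rwa [hreal l _ h0 (hgen l _ (hf l))]
  have hsum : B (f.sum fun _ x => x) (f.sum fun _ x => x) = ∑ l ∈ f.support, B (f l) (f l) := by
    simp only [Finsupp.sum, map_sum, LinearMap.sum_apply]
    refine Finset.sum_congr rfl fun l hl => ?_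
    rw [Finset.sum_eq_single l]
    · intro m _ hm; exact hortho _ _ hm
    · intro h; exact absurd hl h
  rw [hsum, Complex.re_sum] at he
  refine absurd he (not_lt.2 (Finset.sum_nonneg fun l hl => ?_))
  exact (hpos l _ (Finsupp.mem_support_iff.1 hl) (hgen l _ (hf l))).le

end Existence

/-! ### The eigenvalue of nonpositive type of the block matrix -/

section Matrix

open Matrix

/-- The Hermitian form of a Hermitian matrix `H`, as a sesquilinear map. -/
noncomputable def sesqForm {n : Type*} [Fintype n] (H : Matrix n n ℂ) :
    (n → ℂ) →ₗ⋆[ℂ] (n → ℂ) →ₗ[ℂ] ℂ :=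
  LinearMap.mk₂'ₛₗ (starRingEnd ℂ) (RingHom.id ℂ) (fun x y => star x ⬝ᵥ H *ᵥ y)
    (by intro x y z; simp [add_dotProduct])
    (by intro c x y; simp [star_smul, smul_dotProduct])
    (by intro x y z; simp [mulVec_add, dotProduct_add])
    (by intro c x y; simp [mulVec_smul, dotProduct_smul])

theorem sesqForm_apply {n : Type*} [Fintype n] (H : Matrix n n ℂ) (x y : n → ℂ) :
    sesqForm H x y = star x ⬝ᵥ H *ᵥ y := rfl

theorem star_dotProduct_mulVec {n : Type*} [Fintype n] (C : Matrix n n ℂ) (u w : n → ℂ) :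
    star (C *ᵥ u) ⬝ᵥ w = star u ⬝ᵥ C.conjTranspose *ᵥ w := by
  rw [star_mulVec, dotProduct_mulVec]

theorem star_dotProduct_self {n : Type*} [Fintype n] (v : n → ℂ) :
    star v ⬝ᵥ v = ((∑ i, ‖v i‖ ^ 2 : ℝ) : ℂ) := by
  push_cast
  refine Finset.sum_congr rfl fun i _ => ?_
  simpa using Complex.conj_mul' (v i)

theorem star_dotProduct_self_re {n : Type*} [Fintype n] (v : n → ℂ) :
    (star v ⬝ᵥ v).re = ∑ i, ‖v i‖ ^ 2 := by
  rw [star_dotProduct_self, Complex.ofReal_re]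

theorem eq_zero_of_star_dotProduct_self_re_le {n : Type*} [Fintype n] {v : n → ℂ}
    (h : (star v ⬝ᵥ v).re ≤ 0) : v = 0 := by
  rw [star_dotProduct_self_re] at h
  have hz := (Finset.sum_eq_zero_iff_of_nonneg (fun i _ => by positivity)).1
      (le_antisymm h (Finset.sum_nonneg fun i _ => by positivity))
  ext i
  simpa using hz i (Finset.mem_univ i)

theorem signMatrix_mul_self (N : ℕ) : signMatrix N * signMatrix N = 1 := by
  simp [signMatrix, fromBlocks_multiply]

theorem form_signMatrix {N : ℕ} (x y : Unit ⊕ Fin N → ℂ) :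
    form (signMatrix N) x y = -(star (y (.inl ())) * x (.inl ()))
      + star (y ∘ Sum.inr) ⬝ᵥ (x ∘ Sum.inr) := by
  simp [form, signMatrix, fromBlocks_mulVec, dotProduct, Fintype.sum_sum_type, neg_mulVec]

theorem exists_isEigenvalueOfNonposType {N : ℕ} (a : ℝ) (b : Fin N → ℂ)
    (C : Matrix (Fin N) (Fin N) ℂ) (hC : C.IsHermitian) :
    ∃ β : ℂ, IsEigenvalueOfNonposType (signMatrix N) (blockMatrix a b C) β := by
  set H := signMatrix N
  set X := blockMatrix a b C
  have hX : X.conjTranspose * H = H * X := isHSelfadjoint_blockMatrix a b C hC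
  obtain ⟨l, v, hl, hv, hT, hneg⟩ := exists_eigenvector_nonpos (sesqForm H)
    (by
      intro x hx
      have h0 : H *ᵥ x = 0 := by
        apply eq_zero_of_star_dotProduct_self_re_le
        have h1 := hx (H *ᵥ x)
        rw [sesqForm_apply] at h1
        rw [h1, Complex.zero_re]
      have := congrArg (H *ᵥ ·) h0
      simpa [H, mulVec_mulVec, signMatrix_mul_self] using this)
    (Matrix.toLin' X)
    (by
      intro x y
      simp only [sesqForm_apply, Matrix.toLin'_apply]
      rw [star_dotProduct_mulVec, mulVec_mulVec, mulVec_mulVec, hX])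
    -- The first basis vector is the one negative direction of `signMatrix N`.
    (Sum.elim 1 0)
    (by
      have := form_signMatrix (N := N) (Sum.elim 1 0) (Sum.elim 1 0)
      simp only [form] at this
      simp only [sesqForm_apply]
      rw [this]
      simp)
  exact ⟨l, hl, v, hv, by simpa using hT, by simpa [form, sesqForm_apply] using hneg⟩

/-- An eigenvalue of nonpositive type has an eigenvector with first coordinate `1`. -/
theorem IsEigenvalueOfNonposType.exists_tail {N : ℕ} {a : ℝ} {b : Fin N → ℂ}
    {C : Matrix (Fin N) (Fin N) ℂ} {β : ℂ}
    (h : IsEigenvalueOfNonposType (signMatrix N) (blockMatrix a b C) β) :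
    ∃ u : Fin N → ℂ, (a : ℂ) - star b ⬝ᵥ u = β ∧ b + C *ᵥ u = β • u ∧ (star u ⬝ᵥ u).re ≤ 1 := by
  obtain ⟨-, x, hx, hX, hneg⟩ := h
  rw [form_signMatrix] at hneg
  set c := x (.inl ()) with hc
  set v : Fin N → ℂ := x ∘ Sum.inr with hv
  have hxe : x = Sum.elim (fun _ => c) v := by
    ext i; rcases i with ⟨⟩ | i <;> rfl
  have h1 : (a : ℂ) * c - star b ⬝ᵥ v = β * c := by
    have := congrFun hX (.inl ())
    rw [blockMatrix, fromBlocks_mulVec] at this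
    simpa [mulVec, dotProduct, sub_eq_add_neg, ← hc, Finset.sum_neg_distrib, hv] using this
  have h2 : c • b + C *ᵥ v = β • v := by
    ext i
    have := congrFun hX (.inr i)
    rw [blockMatrix, fromBlocks_mulVec] at this
    simp only [Sum.elim_inr, Pi.add_apply, Pi.smul_apply] at this
    rw [← hv] at this
    rw [Pi.add_apply, Pi.smul_apply, Pi.smul_apply]
    refine Eq.trans ?_ this
    simp [mulVec, dotProduct, ← hc, mul_comm]
  have hvv : (star v ⬝ᵥ v).re = ∑ i, ‖v i‖ ^ 2 := star_dotProduct_self_re v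
  have hneg' : ∑ i, ‖v i‖ ^ 2 ≤ ‖c‖ ^ 2 := by
    rw [← hvv]
    simp at hneg
    rw [← Complex.normSq_eq_norm_sq, Complex.normSq_apply]
    linarith
  -- On vectors with first coordinate zero the form is positive definite.
  have hc0 : c ≠ 0 := by
    intro h0
    apply hx
    have hv0 : v = 0 := by
      apply eq_zero_of_star_dotProduct_self_re_le
      simpa [hvv, h0] using hneg'
    rw [hxe, h0, hv0]
    ext i
    rcases i with i | i <;> rfl
  refine ⟨c⁻¹ • v, ?_, ?_, ?_⟩
  · rw [dotProduct_smul, smul_eq_mul]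
    field_simp
    linear_combination h1
  · rw [mulVec_smul, smul_comm, ← h2, smul_add, smul_smul, inv_mul_cancel₀ hc0, one_smul]
  · rw [star_dotProduct_self_re]
    simp only [Pi.smul_apply, smul_eq_mul, norm_mul, norm_inv, mul_pow, ← Finset.mul_sum]
    rw [inv_pow, inv_mul_le_one₀ (by positivity)]
    exact hneg'

/-- Symmetry of C forces the two normalised tails to have inner product 1. Both have norm at most 1,
so they coincide, and the tail determines the eigenvalue. -/
theorem IsEigenvalueOfNonposType.unique {N : ℕ} {a : ℝ} {b : Fin N → ℂ}
    {C : Matrix (Fin N) (Fin N) ℂ} (hC : C.IsHermitian) {β₁ β₂ : ℂ}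
    (h₁ : IsEigenvalueOfNonposType (signMatrix N) (blockMatrix a b C) β₁)
    (h₂ : IsEigenvalueOfNonposType (signMatrix N) (blockMatrix a b C) β₂) : β₁ = β₂ := by
  by_contra hne
  obtain ⟨u, hu1, hu2, hu3⟩ := h₁.exists_tail
  obtain ⟨w, hw1, hw2, hw3⟩ := h₂.exists_tail
  -- In the closed upper half-plane conjugate points are equal, so the factor cancelled in `huw` is
  -- nonzero.
  have hne' : star β₁ ≠ β₂ := by
    intro h
    apply hne
    have him : β₂.im = -β₁.im := by rw [← h]; simp
    have := h₁.1
    have := h₂.1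
    apply Complex.ext
    · rw [← h]; simp
    · linarith
  have hu2' : C *ᵥ u = β₁ • u - b := by rw [← hu2]; abel
  have hw2' : C *ᵥ w = β₂ • w - b := by rw [← hw2]; abel
  have hCuw := star_dotProduct_mulVec C u w
  rw [hC.eq, hu2', hw2'] at hCuw
  simp only [star_sub, star_smul, sub_dotProduct, dotProduct_sub, smul_dotProduct,
    dotProduct_smul, smul_eq_mul] at hCuw
  have hub : star u ⬝ᵥ b = a - star β₁ := by
    rw [star_dotProduct, ← hu1]; simp
  have hbw : star b ⬝ᵥ w = a - β₂ := by rw [← hw1]; ring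
  have huw : star u ⬝ᵥ w = 1 := by
    rw [hub, hbw] at hCuw
    have : (star β₁ - β₂) * (star u ⬝ᵥ w - 1) = 0 := by linear_combination hCuw
    exact sub_eq_zero.1 ((mul_eq_zero.1 this).resolve_left (sub_ne_zero.2 hne'))
  have hwu : star w ⬝ᵥ u = 1 := by rw [star_dotProduct, huw]; simp
  have hd : (star (u - w) ⬝ᵥ (u - w)).re ≤ 0 := by
    simp only [star_sub, sub_dotProduct, dotProduct_sub, huw, hwu]
    simp
    linarith
  have : u = w := sub_eq_zero.1 (eq_zero_of_star_dotProduct_self_re_le hd)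
  rw [this] at hu1
  exact hne (hu1.symm.trans hw1)

end Matrix

/-! ### Resolvents of Hermitian matrices and Julia's inequality -/

section Resolvent

open Matrix

theorem norm_star_dotProduct_sq_le {n : Type*} [Fintype n] (u p : n → ℂ) :
    ‖star u ⬝ᵥ p‖ ^ 2 ≤ (star u ⬝ᵥ u).re * (star p ⬝ᵥ p).re := by
  have h := norm_inner_le_norm (𝕜 := ℂ) (WithLp.toLp 2 u) (WithLp.toLp 2 p)
  rw [EuclideanSpace.inner_eq_star_dotProduct, dotProduct_comm] at h
  have h2 := pow_le_pow_left₀ (norm_nonneg _) h 2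
  rw [mul_pow, EuclideanSpace.norm_sq_eq, EuclideanSpace.norm_sq_eq] at h2
  rwa [star_dotProduct_self_re, star_dotProduct_self_re]

/-- The resolvent `(C - z)⁻¹`. -/
noncomputable def resolventMatrix {n : Type*} [Fintype n] [DecidableEq n] (C : Matrix n n ℂ)
    (z : ℂ) : Matrix n n ℂ := (C - z • (1 : Matrix n n ℂ))⁻¹

variable {n : Type*} [Fintype n] [DecidableEq n]

/-- The quadratic form of C is real, so only z contributes. This one identity yields invertibility
of C - z, the resolvent bound and the formula for Im F. -/
theorem im_star_dotProduct_mulVec_sub {C : Matrix n n ℂ} (hC : C.IsHermitian) (z : ℂ) (v : n → ℂ) :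
    (star v ⬝ᵥ (C - z • (1 : Matrix n n ℂ)) *ᵥ v).im = -(z.im * (star v ⬝ᵥ v).re) := by
  have h1 : (star v ⬝ᵥ C *ᵥ v).im = 0 := by
    have h := star_dotProduct_mulVec C v v
    rw [hC.eq, star_dotProduct] at h
    have := congrArg Complex.im h
    simp at this
    linarith
  have h2 : (star v ⬝ᵥ v).im = 0 := by rw [star_dotProduct_self, Complex.ofReal_im]
  simp [sub_mulVec, smul_mulVec, h1, h2]

theorem isUnit_sub_smul_one {C : Matrix n n ℂ} (hC : C.IsHermitian) {z : ℂ} (hz : z.im ≠ 0) :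
    IsUnit (C - z • (1 : Matrix n n ℂ)).det := by
  rw [isUnit_iff_ne_zero, Ne, ← exists_mulVec_eq_zero_iff]
  rintro ⟨v, hv, h⟩
  have h1 := im_star_dotProduct_mulVec_sub hC z v
  rw [h, dotProduct_zero] at h1
  simp only [Complex.zero_im, zero_eq_neg, mul_eq_zero, hz, false_or] at h1
  exact hv (eq_zero_of_star_dotProduct_self_re_le h1.le)

theorem mulVec_resolventMatrix {C : Matrix n n ℂ} (hC : C.IsHermitian) {z : ℂ} (hz : z.im ≠ 0)
    (w : n → ℂ) : C *ᵥ (resolventMatrix C z *ᵥ w) = z • (resolventMatrix C z *ᵥ w) + w := by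
  have h : (C - z • (1 : Matrix n n ℂ)) *ᵥ (resolventMatrix C z *ᵥ w) = w := by
    rw [resolventMatrix, mulVec_mulVec, mul_nonsing_inv _ (isUnit_sub_smul_one hC hz), one_mulVec]
  rw [sub_mulVec, smul_mulVec, one_mulVec] at h
  rw [← sub_eq_iff_eq_add', h]

theorem resolventMatrix_mulVec_eq {C : Matrix n n ℂ} (hC : C.IsHermitian) {z : ℂ} (hz : z.im ≠ 0)
    {v w : n → ℂ} (h : C *ᵥ v = z • v + w) : resolventMatrix C z *ᵥ w = v := by
  have : w = (C - z • (1 : Matrix n n ℂ)) *ᵥ v := by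
    rw [sub_mulVec, smul_mulVec, one_mulVec, h]; abel
  rw [this, resolventMatrix, mulVec_mulVec, nonsing_inv_mul _ (isUnit_sub_smul_one hC hz),
    one_mulVec]

/-- With v = (C - z)⁻¹w, Im z · |v|² = |Im v*w| ≤ |v||w|. -/
theorem resolventMatrix_mulVec_norm_sq_le {C : Matrix n n ℂ} (hC : C.IsHermitian) {z : ℂ}
    (hz : 0 < z.im) (w : n → ℂ) :
    z.im ^ 2 * ∑ i, ‖(resolventMatrix C z *ᵥ w) i‖ ^ 2 ≤ ∑ i, ‖w i‖ ^ 2 := by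
  set v := resolventMatrix C z *ᵥ w with hv
  have h := im_star_dotProduct_mulVec_sub hC z v
  rw [sub_mulVec, smul_mulVec, one_mulVec, mulVec_resolventMatrix hC hz.ne',
    add_sub_cancel_left] at h
  have h1 := norm_star_dotProduct_sq_le v w
  have h2 := Complex.abs_im_le_norm (star v ⬝ᵥ w)
  rw [h, abs_neg] at h2
  simp only [star_dotProduct_self_re] at h1 h2
  set V := ∑ i, ‖v i‖ ^ 2
  set W := ∑ i, ‖w i‖ ^ 2
  have hV : 0 ≤ V := Finset.sum_nonneg fun i _ => by positivity
  have hW : 0 ≤ W := Finset.sum_nonneg fun i _ => by positivity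
  have h3 := pow_le_pow_left₀ (abs_nonneg _) h2 2
  rw [sq_abs] at h3
  rcases hV.eq_or_lt with h0 | h0
  · rw [← h0]; simpa using hW
  · have : V * (z.im ^ 2 * V) ≤ V * W := by nlinarith
    exact le_of_mul_le_mul_left this h0

theorem resolventMatrix_col_norm_sq_le {C : Matrix n n ℂ} (hC : C.IsHermitian) {z : ℂ}
    (hz : 0 < z.im) (j : n) : ∑ i, ‖resolventMatrix C z i j‖ ^ 2 ≤ (z.im⁻¹) ^ 2 := by
  have h := resolventMatrix_mulVec_norm_sq_le hC hz (Pi.single j 1)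
  have h1 : ∑ i, ‖(Pi.single j 1 : n → ℂ) i‖ ^ 2 = 1 := by
    rw [Finset.sum_eq_single j] <;> simp +contextual
  rw [h1] at h
  simp only [mulVec_single_one, col_apply] at h
  rw [inv_pow, ← one_div, le_div_iff₀' (by positivity)]
  exact h

theorem trace_resolventMatrix {C : Matrix n n ℂ} (hC : C.IsHermitian) {z : ℂ} (hz : z.im ≠ 0) :
    (resolventMatrix C z).trace = ∑ j, 1 / ((hC.eigenvalues j : ℂ) - z) := by
  set U : Matrix n n ℂ := ↑hC.eigenvectorUnitary with hU
  have hU1 : U * star U = 1 := Unitary.coe_mul_star_self hC.eigenvectorUnitary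
  have hU2 : star U * U = 1 := Unitary.coe_star_mul_self hC.eigenvectorUnitary
  have hsp : C = U * diagonal (fun j => (hC.eigenvalues j : ℂ)) * star U := by
    conv_lhs => rw [hC.spectral_theorem]
    rw [Unitary.conjStarAlgAut_apply]
    rfl
  set D := diagonal (fun j => 1 / ((hC.eigenvalues j : ℂ) - z)) with hD
  have hinv : (C - z • (1 : Matrix n n ℂ)) * (U * D * star U) = 1 := by
    have h1 : C - z • (1 : Matrix n n ℂ)
        = U * diagonal (fun j => (hC.eigenvalues j : ℂ) - z) * star U := by
      have : diagonal (fun j => (hC.eigenvalues j : ℂ) - z)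
          = diagonal (fun j => (hC.eigenvalues j : ℂ)) - z • (1 : Matrix n n ℂ) := by
        rw [← diagonal_one, ← diagonal_smul, diagonal_sub]
        congr 1; ext j; simp
      rw [this, mul_sub, sub_mul, ← hsp, Matrix.mul_smul, Matrix.smul_mul, mul_one, hU1]
    have h2 : diagonal (fun j => (hC.eigenvalues j : ℂ) - z) * D = 1 := by
      rw [hD, diagonal_mul_diagonal, ← diagonal_one]
      congr 1; ext j
      have : (hC.eigenvalues j : ℂ) - z ≠ 0 := by
        intro h
        apply hz
        have := congrArg Complex.im h
        simpa using this
      field_simp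
    rw [h1]
    calc _ = U * diagonal (fun j => (hC.eigenvalues j : ℂ) - z) * (star U * U) * D * star U := by
          simp only [mul_assoc]
      _ = 1 := by rw [hU2, mul_one, mul_assoc U, h2, mul_one, hU1]
  rw [resolventMatrix, inv_eq_right_inv hinv, trace_mul_comm, ← mul_assoc, hU2, one_mul, hD,
    trace_diagonal]

/-- The inequality of Julia's lemma for a function `F` on the upper half-plane and a point `β`. -/
def JuliaInequality (F : ℂ → ℂ) (β z : ℂ) : Prop :=
  ‖F z - β‖ ^ 2 * z.im ≤ ‖z - β‖ ^ 2 * (F z).im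

/-- The function `a + b^* (C - z)⁻¹ b`. -/
noncomputable def transferFunction (a : ℝ) (b : n → ℂ) (C : Matrix n n ℂ) (z : ℂ) : ℂ :=
  a + star b ⬝ᵥ resolventMatrix C z *ᵥ b

/-- Everything is expressed by g = (C - z)⁻¹u. One has F(z) - β = (z - β) u*p and Im F(z) = Im z ·
|v|² with |v| = |p|, so Cauchy–Schwarz and |u| ≤ 1 finish. -/
theorem IsEigenvalueOfNonposType.juliaInequality {N : ℕ} {a : ℝ} {b : Fin N → ℂ}
    {C : Matrix (Fin N) (Fin N) ℂ} (hC : C.IsHermitian) {β : ℂ}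
    (h : IsEigenvalueOfNonposType (signMatrix N) (blockMatrix a b C) β) {z : ℂ} (hz : 0 < z.im) :
    JuliaInequality (transferFunction a b C) β z := by
  obtain ⟨u, hu1, hu2, hu3⟩ := h.exists_tail
  have hCu : C *ᵥ u = β • u - b := by rw [← hu2]; abel
  set g := resolventMatrix C z *ᵥ u with hg
  have hCg : C *ᵥ g = z • g + u := mulVec_resolventMatrix hC hz.ne' u
  -- Here v = (C - β)g and p = (C - β̄)g. Their norms agree because C - β is normal with adjoint C -
  -- β̄.
  set v := u + (z - β) • g with hv
  set p := u + (z - star β) • g with hp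
  have hCv : C *ᵥ v = z • v - b := by
    rw [hv, mulVec_add, mulVec_smul, hCu, hCg]
    module
  have hres : resolventMatrix C z *ᵥ b = -v := by
    apply resolventMatrix_mulVec_eq hC hz.ne'
    rw [mulVec_neg, hCv]; module
  have hF : transferFunction a b C z = a - star b ⬝ᵥ v := by
    rw [transferFunction, hres, dotProduct_neg, sub_eq_add_neg]
  have hbg : -(star b ⬝ᵥ g) = star u ⬝ᵥ p := by
    have hb : b = β • u - C *ᵥ u := by rw [hCu]; abel
    rw [hb, star_sub, sub_dotProduct, star_dotProduct_mulVec, hC.eq, hCg, hp, star_smul]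
    simp only [smul_dotProduct, dotProduct_add, dotProduct_smul, smul_eq_mul]
    ring
  have hFβ : transferFunction a b C z - β = (z - β) * (star u ⬝ᵥ p) := by
    rw [hF, ← hbg, hv, dotProduct_add, dotProduct_smul, smul_eq_mul]
    linear_combination hu1
  have hFim : (transferFunction a b C z).im = z.im * (star v ⬝ᵥ v).re := by
    have h1 := im_star_dotProduct_mulVec_sub hC z v
    rw [sub_mulVec, smul_mulVec, one_mulVec, hCv] at h1
    have h2 : z • v - b - z • v = -b := by abel
    rw [h2, dotProduct_neg, star_dotProduct] at h1
    rw [hF]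
    simp at h1 ⊢
    linarith
  have hvp : (star v ⬝ᵥ v).re = (star p ⬝ᵥ p).re := by
    have h1 := im_star_dotProduct_mulVec_sub hC z g
    rw [sub_mulVec, smul_mulVec, one_mulVec, hCg, add_sub_cancel_left] at h1
    have h2 : star u ⬝ᵥ g = star (star g ⬝ᵥ u) := star_dotProduct _ _
    have h3 := star_dotProduct_self g
    have h4 := star_dotProduct_self u
    simp only [hv, hp, star_add, star_smul, add_dotProduct, dotProduct_add, smul_dotProduct,
      dotProduct_smul, smul_eq_mul, h2, h3, h4]
    rw [h3] at h1
    set G := ∑ i, ‖g i‖ ^ 2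
    set γ := star g ⬝ᵥ u
    simp at h1 ⊢
    rw [h1]
    ring
  rw [JuliaInequality, hFβ, hFim, norm_mul, mul_pow]
  have hCS := norm_star_dotProduct_sq_le u p
  have hpp : 0 ≤ (star p ⬝ᵥ p).re := by
    rw [star_dotProduct_self_re]; exact Finset.sum_nonneg fun i _ => by positivity
  have : ‖star u ⬝ᵥ p‖ ^ 2 ≤ (star v ⬝ᵥ v).re := by
    rw [hvp]; nlinarith
  calc ‖z - β‖ ^ 2 * ‖star u ⬝ᵥ p‖ ^ 2 * z.im ≤ ‖z - β‖ ^ 2 * (star v ⬝ᵥ v).re * z.im := by gcongr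
    _ = _ := by ring

end Resolvent

/-! ### Stieltjes transforms and uniqueness of the attracting fixed point -/

section Stieltjes

variable {σ : Measure ℝ}

theorem ofReal_sub_ne_zero {z : ℂ} (hz : z.im ≠ 0) (t : ℝ) : (t : ℂ) - z ≠ 0 := by
  intro h
  apply hz
  simpa using congrArg Complex.im h

theorem abs_im_le_norm_ofReal_sub (z : ℂ) (t : ℝ) : |z.im| ≤ ‖(t : ℂ) - z‖ := by
  have := Complex.abs_im_le_norm ((t : ℂ) - z)
  simpa using this

theorem measurable_cauchyKernel (z : ℂ) : Measurable fun t : ℝ => 1 / ((t : ℂ) - z) := by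
  fun_prop

theorem continuous_cauchyKernel {z : ℂ} (hz : z.im ≠ 0) :
    Continuous fun t : ℝ => 1 / ((t : ℂ) - z) :=
  continuous_const.div (by fun_prop) (ofReal_sub_ne_zero hz)

theorem norm_cauchyKernel_le {z : ℂ} (hz : 0 < z.im) (t : ℝ) :
    ‖1 / ((t : ℂ) - z)‖ ≤ z.im⁻¹ := by
  rw [norm_div, norm_one, one_div]
  have := abs_im_le_norm_ofReal_sub z t
  rw [abs_of_pos hz] at this
  exact inv_anti₀ hz this

theorem integrable_cauchyKernel [IsFiniteMeasure σ] {z : ℂ} (hz : 0 < z.im) :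
    Integrable (fun t : ℝ => 1 / ((t : ℂ) - z)) σ :=
  Integrable.of_bound (measurable_cauchyKernel z).aestronglyMeasurable z.im⁻¹
    (ae_of_all _ (norm_cauchyKernel_le hz))

theorem integrable_cauchyKernel_sq [IsFiniteMeasure σ] {z : ℂ} (hz : 0 < z.im) :
    Integrable (fun t : ℝ => 1 / ‖(t : ℂ) - z‖ ^ 2) σ := by
  refine Integrable.of_bound (Measurable.aestronglyMeasurable (by fun_prop)) (z.im⁻¹ ^ 2)
    (ae_of_all _ fun t => ?_)
  have := norm_cauchyKernel_le hz t
  have h2 := pow_le_pow_left₀ (norm_nonneg _) this 2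
  rw [norm_div, norm_one, div_pow, one_pow] at h2
  rwa [Real.norm_of_nonneg (by positivity)]

theorem norm_stieltjes_le [IsFiniteMeasure σ] {z : ℂ} (hz : 0 < z.im) :
    ‖stieltjes σ z‖ ≤ z.im⁻¹ * σ.real Set.univ :=
  norm_integral_le_of_norm_le_const (ae_of_all _ (norm_cauchyKernel_le hz))

theorem im_stieltjes [IsFiniteMeasure σ] {z : ℂ} (hz : 0 < z.im) :
    (stieltjes σ z).im = z.im * ∫ t : ℝ, 1 / ‖(t : ℂ) - z‖ ^ 2 ∂σ := by
  have h := integral_im (𝕜 := ℂ) (integrable_cauchyKernel (σ := σ) hz)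
  rw [stieltjes]
  change RCLike.im (∫ t : ℝ, 1 / ((t : ℂ) - z) ∂σ) = _
  rw [← h, ← integral_const_mul]
  congr 1
  ext t
  change (1 / ((t : ℂ) - z)).im = _
  rw [one_div, Complex.inv_im, Complex.normSq_eq_norm_sq]
  simp
  ring

/-- `β` is a fixed point of the Stieltjes transform of `σ` at which the derivative is at
most `1` in absolute value, boundary points being understood via the integrals themselves. -/
structure IsAttractingFixedPoint (σ : Measure ℝ) (β : ℂ) : Prop where
  ae_ne : ∀ᵐ t : ℝ ∂σ, (t : ℂ) - β ≠ 0
  integrable : Integrable (fun t : ℝ => 1 / ‖(t : ℂ) - β‖ ^ 2) σ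
  integral_le : ∫ t : ℝ, 1 / ‖(t : ℂ) - β‖ ^ 2 ∂σ ≤ 1
  stieltjes_eq : stieltjes σ β = β

theorem integrable_cauchyKernel_of_sq [IsFiniteMeasure σ] {β : ℂ}
    (h : Integrable (fun t : ℝ => 1 / ‖(t : ℂ) - β‖ ^ 2) σ) :
    Integrable (fun t : ℝ => 1 / ((t : ℂ) - β)) σ := by
  refine ((integrable_const (1 : ℝ)).add h).mono'
    (measurable_cauchyKernel β).aestronglyMeasurable (ae_of_all _ fun t => ?_)
  have : (1 : ℝ) / ‖(t : ℂ) - β‖ ^ 2 = ‖1 / ((t : ℂ) - β)‖ ^ 2 := by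
    rw [norm_div, norm_one, div_pow, one_pow]
  simp only [Pi.add_apply, this]
  nlinarith [sq_nonneg (‖1 / ((t : ℂ) - β)‖ - 1)]

/-- Put f = 1/(t - β₁) and g = 1/(t - β₂). Subtracting the fixed point equations gives ∫fg dσ = 1,
while f and g have L² norm at most 1. Hence ∫|g - f̄|² ≤ 0, so β₂ is the conjugate of β₁, and the
half-plane condition makes them equal. -/
theorem IsAttractingFixedPoint.unique [IsFiniteMeasure σ] {β₁ β₂ : ℂ}
    (h₁ : IsAttractingFixedPoint σ β₁) (h₂ : IsAttractingFixedPoint σ β₂) (him₁ : 0 ≤ β₁.im)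
    (him₂ : 0 ≤ β₂.im) : β₁ = β₂ := by
  by_contra hne
  set f : ℝ → ℂ := fun t => 1 / ((t : ℂ) - β₁) with hf
  set g : ℝ → ℂ := fun t => 1 / ((t : ℂ) - β₂) with hg
  have hfi : Integrable f σ := integrable_cauchyKernel_of_sq h₁.integrable
  have hgi : Integrable g σ := integrable_cauchyKernel_of_sq h₂.integrable
  have hf2 : (fun t : ℝ => 1 / ‖(t : ℂ) - β₁‖ ^ 2) = fun t => ‖f t‖ ^ 2 := by
    ext t; simp only [hf]; rw [norm_div, norm_one, div_pow, one_pow]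
  have hg2 : (fun t : ℝ => 1 / ‖(t : ℂ) - β₂‖ ^ 2) = fun t => ‖g t‖ ^ 2 := by
    ext t; simp only [hg]; rw [norm_div, norm_one, div_pow, one_pow]
  have hfs := h₁.integrable
  have hgs := h₂.integrable
  have hfl := h₁.integral_le
  have hgl := h₂.integral_le
  rw [hf2] at hfs hfl
  rw [hg2] at hgs hgl
  have hfg : Integrable (fun t => f t * g t) σ := by
    refine (hfs.add hgs).mono' (hfi.1.mul hgi.1) (ae_of_all _ fun t => ?_)
    rw [norm_mul, Pi.add_apply]
    nlinarith [sq_nonneg (‖f t‖ - ‖g t‖), sq_nonneg (‖f t‖ + ‖g t‖)]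
  have hone : ∫ t, f t * g t ∂σ = 1 := by
    have e1 : ∫ t, (f t - g t) ∂σ = β₁ - β₂ := by
      rw [integral_sub hfi hgi]
      exact congrArg₂ (· - ·) h₁.stieltjes_eq h₂.stieltjes_eq
    -- The resolvent identity f - g = (β₁ - β₂)fg.
    have e2 : ∫ t, (f t - g t) ∂σ = (β₁ - β₂) * ∫ t, f t * g t ∂σ := by
      rw [← integral_const_mul]
      apply integral_congr_ae
      filter_upwards [h₁.ae_ne, h₂.ae_ne] with t ht1 ht2
      simp only [hf, hg]
      field_simp
      ring
    have h3 := sub_ne_zero.2 hne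
    have : (β₁ - β₂) * ∫ t, f t * g t ∂σ = (β₁ - β₂) * 1 := by rw [← e2, e1, mul_one]
    exact mul_left_cancel₀ h3 this
  have hpt : ∀ t, ‖g t - star (f t)‖ ^ 2 = ‖f t‖ ^ 2 + ‖g t‖ ^ 2 - 2 * (f t * g t).re := by
    intro t
    simp only [← Complex.normSq_eq_norm_sq, Complex.normSq_apply]
    simp
    ring
  have hre : Integrable (fun t => (f t * g t).re) σ := hfg.re
  have hfgs : Integrable (fun t => ‖f t‖ ^ 2 + ‖g t‖ ^ 2) σ := hfs.add hgs
  have hint : Integrable (fun t => ‖g t - star (f t)‖ ^ 2) σ := by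
    simp only [hpt]
    exact hfgs.sub (hre.const_mul 2)
  have hzero : ∫ t, ‖g t - star (f t)‖ ^ 2 ∂σ = 0 := by
    apply le_antisymm _ (integral_nonneg fun t => by positivity)
    simp only [hpt]
    rw [integral_sub hfgs (hre.const_mul 2), integral_add hfs hgs, integral_const_mul]
    have : ∫ t, (f t * g t).re ∂σ = 1 := by
      have := integral_re (𝕜 := ℂ) hfg
      rw [hone] at this
      simpa using this
    linarith
  rw [integral_eq_zero_iff_of_nonneg (fun t => by positivity) hint] at hzero
  have hσ : σ ≠ 0 := by
    intro h0
    rw [h0] at hone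
    simp at hone
  have : (ae σ).NeBot := ae_neBot.2 hσ
  obtain ⟨t, ht, ht1, ht2⟩ := (hzero.and (h₁.ae_ne.and h₂.ae_ne)).exists
  simp only [Pi.zero_apply, ne_eq, OfNat.ofNat_ne_zero, not_false_eq_true, pow_eq_zero_iff,
    norm_eq_zero, sub_eq_zero, hf, hg] at ht
  simp only [one_div] at ht
  have ht' := congrArg star ht
  simp at ht'
  apply hne
  have hre' := congrArg Complex.re ht'
  have him' := congrArg Complex.im ht'
  simp at hre' him'
  apply Complex.ext <;> linarith

end Stieltjes

/-! ### Boundary behaviour: GZNTs, fixed points and Julia's inequality -/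

section Boundary

variable {σ : Measure ℝ}

theorem sector_im_ge {x θ : ℝ} (hθ : 0 < θ) (hθ' : θ < Real.pi / 2) {z : ℂ} (hz : z ∈ sector x θ) :
    Real.cos θ * ‖z - x‖ ≤ z.im := by
  obtain ⟨-, h1, h2⟩ := hz
  set w := z - (x : ℂ) with hw
  have him : z.im = w.im := by simp [hw]
  have hsin : Real.sin w.arg = Real.cos |w.arg - Real.pi / 2| := by
    rw [Real.cos_abs, Real.cos_sub_pi_div_two]
  have hle : Real.cos θ ≤ Real.sin w.arg := by
    rw [hsin]
    apply Real.cos_le_cos_of_nonneg_of_le_pi (abs_nonneg _) (by linarith [Real.pi_pos])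
    rw [abs_le]; constructor <;> linarith
  rw [him, ← Complex.norm_mul_sin_arg w, mul_comm]
  gcongr

/-- In a sector, distances from z to the real line are comparable with those from the vertex. This
provides the domination for non-tangential limits. -/
theorem sector_norm_sub_ge {x θ : ℝ} (hθ : 0 < θ) (hθ' : θ < Real.pi / 2) {z : ℂ}
    (hz : z ∈ sector x θ) (t : ℝ) : Real.cos θ * ‖(t : ℂ) - x‖ ≤ ‖(t : ℂ) - z‖ := by
  have h := sector_im_ge hθ hθ' hz
  have hz0 := hz.1
  have hc : 0 < Real.cos θ := Real.cos_pos_of_mem_Ioo ⟨by linarith, hθ'⟩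
  set c := Real.cos θ
  have h' := pow_le_pow_left₀ (by positivity) h 2
  apply le_of_sq_le_sq _ (norm_nonneg _)
  rw [mul_pow, ← Complex.normSq_eq_norm_sq] at h' ⊢
  rw [← Complex.normSq_eq_norm_sq]
  simp only [Complex.normSq_apply, Complex.sub_re, Complex.sub_im, Complex.ofReal_re,
    Complex.ofReal_im, sub_zero, mul_zero, add_zero, zero_sub] at h' ⊢
  set p := z.re - x with hp
  set s := t - x with hs
  have e1 : t - z.re = s - p := by rw [hp, hs]; ring
  rw [e1]
  set y := z.im
  have hpos : 0 < p * p + y * y := by nlinarith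
  -- Rests on ((s - p)² + y²)(p² + y²) = (sp - p² - y²)² + s²y² and on `h'`, which says y² ≥ c²(p² +
  -- y²).
  have hkey : 0 ≤ ((s - p) * (s - p) + -y * -y - c ^ 2 * (s * s)) * (p * p + y * y) := by
    nlinarith [sq_nonneg (s * p - (p * p + y * y)), mul_le_mul_of_nonneg_left h' (mul_self_nonneg s)]
  have := nonneg_of_mul_nonneg_left hkey hpos
  linarith

theorem tendsto_vertical_nhdsWithin_sector (x : ℝ) {θ : ℝ} (hθ : 0 < θ) :
    Tendsto (fun y : ℝ => (x : ℂ) + y * Complex.I) (𝓝[>] 0) (𝓝[sector x θ] (x : ℂ)) := by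
  apply tendsto_nhdsWithin_iff.2 ⟨?_, ?_⟩
  · apply tendsto_nhdsWithin_of_tendsto_nhds
    have : Continuous fun y : ℝ => (x : ℂ) + y * Complex.I := by fun_prop
    simpa using this.tendsto 0
  · filter_upwards [self_mem_nhdsWithin] with y (hy : 0 < y)
    have harg : ((x : ℂ) + y * Complex.I - x).arg = Real.pi / 2 := by
      rw [add_sub_cancel_left, Complex.arg_real_mul _ hy, Complex.arg_I]
    refine ⟨by simpa using hy, ?_, ?_⟩ <;> rw [harg] <;> linarith

/-- An atom at x alone would contribute its mass divided by y² to the integral. -/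
theorem measure_singleton_of_integral_le [IsFiniteMeasure σ] {x : ℝ}
    (h : ∃ K : ℝ, ∀ᶠ y : ℝ in 𝓝[>] 0,
      ∫ t : ℝ, 1 / ‖(t : ℂ) - (x + y * Complex.I)‖ ^ 2 ∂σ ≤ K) : σ.real {x} = 0 := by
  obtain ⟨K, hK⟩ := h
  have hev : ∀ᶠ y : ℝ in 𝓝[>] 0, σ.real {x} ≤ K * y ^ 2 := by
    filter_upwards [hK, self_mem_nhdsWithin] with y hy (hy0 : 0 < y)
    have him : 0 < ((x : ℂ) + y * Complex.I).im := by simpa using hy0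
    have h1 := setIntegral_le_integral (s := {x}) (integrable_cauchyKernel_sq (σ := σ) him)
      (ae_of_all _ fun t => by positivity)
    have h2 : ∫ t in ({x} : Set ℝ), 1 / ‖(t : ℂ) - (x + y * Complex.I)‖ ^ 2 ∂σ
        = σ.real {x} * (1 / y ^ 2) := by
      rw [integral_singleton]
      simp
    rw [h2] at h1
    have h3 := h1.trans hy
    rwa [mul_one_div, div_le_iff₀ (by positivity)] at h3
  have hlim : Tendsto (fun y : ℝ => K * y ^ 2) (𝓝[>] 0) (𝓝 0) := by
    apply tendsto_nhdsWithin_of_tendsto_nhds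
    have : Continuous fun y : ℝ => K * y ^ 2 := by fun_prop
    simpa using this.tendsto 0
  exact le_antisymm (ge_of_tendsto hlim hev) measureReal_nonneg

theorem ae_ne_of_integral_le [IsFiniteMeasure σ] {x : ℝ}
    (h : ∃ K : ℝ, ∀ᶠ y : ℝ in 𝓝[>] 0,
      ∫ t : ℝ, 1 / ‖(t : ℂ) - (x + y * Complex.I)‖ ^ 2 ∂σ ≤ K) :
    ∀ᵐ t : ℝ ∂σ, (t : ℂ) - x ≠ 0 := by
  have h0 := measure_singleton_of_integral_le h
  rw [measureReal_eq_zero_iff] at h0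
  refine measure_mono_null (fun t ht => ?_) h0
  simpa [sub_eq_zero] using ht

/-- Fatou's lemma along a sequence y → 0+; the integrands converge almost everywhere since x carries
no mass. -/
theorem lintegral_le_of_integral_le [IsFiniteMeasure σ] {x K : ℝ}
    (h : ∀ᶠ y : ℝ in 𝓝[>] 0, ∫ t : ℝ, 1 / ‖(t : ℂ) - (x + y * Complex.I)‖ ^ 2 ∂σ ≤ K) :
    ∫⁻ t : ℝ, ENNReal.ofReal (1 / ‖(t : ℂ) - x‖ ^ 2) ∂σ ≤ ENNReal.ofReal K := by
  have hae := ae_ne_of_integral_le ⟨K, h⟩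
  obtain ⟨u, hu⟩ := exists_seq_tendsto (𝓝[>] (0 : ℝ))
  have hpt : ∀ᵐ t : ℝ ∂σ, ENNReal.ofReal (1 / ‖(t : ℂ) - x‖ ^ 2) = liminf (fun n =>
      ENNReal.ofReal (1 / ‖(t : ℂ) - (x + u n * Complex.I)‖ ^ 2)) atTop := by
    filter_upwards [hae] with t ht
    symm
    apply Tendsto.liminf_eq
    apply (ENNReal.continuous_ofReal.tendsto _).comp
    have hu0 : Tendsto u atTop (𝓝 0) := hu.mono_right nhdsWithin_le_nhds
    have h1 : Tendsto (fun n => ‖(t : ℂ) - (x + u n * Complex.I)‖ ^ 2) atTop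
        (𝓝 (‖(t : ℂ) - x‖ ^ 2)) := by
      have : Continuous fun y : ℝ => ‖(t : ℂ) - (x + y * Complex.I)‖ ^ 2 := by fun_prop
      have h2 := (this.tendsto 0).comp hu0
      simpa [Function.comp_def] using h2
    exact tendsto_const_nhds.div h1 (pow_ne_zero 2 (norm_ne_zero_iff.2 ht))
  rw [lintegral_congr_ae hpt]
  refine (lintegral_liminf_le fun n => by fun_prop).trans ?_
  apply liminf_le_of_frequently_le'
  apply Eventually.frequently
  filter_upwards [hu.eventually h, hu.eventually self_mem_nhdsWithin] with n hn (hn0 : 0 < u n)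
  have him : 0 < ((x : ℂ) + u n * Complex.I).im := by simpa using hn0
  rw [← ofReal_integral_eq_lintegral_ofReal (integrable_cauchyKernel_sq him)
    (ae_of_all _ fun t => by positivity)]
  exact ENNReal.ofReal_le_ofReal hn

theorem integrable_and_integral_le_one [IsFiniteMeasure σ] {x : ℝ}
    (h : ∀ K : ℝ, 1 < K → ∀ᶠ y : ℝ in 𝓝[>] 0,
      ∫ t : ℝ, 1 / ‖(t : ℂ) - (x + y * Complex.I)‖ ^ 2 ∂σ ≤ K) :
    Integrable (fun t : ℝ => 1 / ‖(t : ℂ) - x‖ ^ 2) σ ∧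
      ∫ t : ℝ, 1 / ‖(t : ℂ) - x‖ ^ 2 ∂σ ≤ 1 := by
  have hm : Measurable fun t : ℝ => 1 / ‖(t : ℂ) - x‖ ^ 2 := by fun_prop
  have hle : ∫⁻ t : ℝ, ENNReal.ofReal (1 / ‖(t : ℂ) - x‖ ^ 2) ∂σ ≤ ENNReal.ofReal 1 := by
    have hlim : Tendsto (fun K : ℝ => ENNReal.ofReal K) (𝓝[>] 1) (𝓝 (ENNReal.ofReal 1)) :=
      (ENNReal.continuous_ofReal.tendsto 1).mono_left nhdsWithin_le_nhds
    refine ge_of_tendsto hlim ?_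
    filter_upwards [self_mem_nhdsWithin] with K hK
    exact lintegral_le_of_integral_le (h K hK)
  constructor
  · refine ⟨hm.aestronglyMeasurable, ?_⟩
    rw [hasFiniteIntegral_iff_ofReal (ae_of_all _ fun t => by positivity)]
    exact hle.trans_lt ENNReal.ofReal_lt_top
  · rw [integral_eq_lintegral_of_nonneg_ae (ae_of_all _ fun t => by positivity)
      hm.aestronglyMeasurable]
    exact ENNReal.toReal_le_of_le_ofReal zero_le_one hle

/-- The non-tangential derivative of the Stieltjes transform at a boundary point. -/
theorem nontangentialTendsto_slope_stieltjes [IsFiniteMeasure σ] {x : ℝ}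
    (hae : ∀ᵐ t : ℝ ∂σ, (t : ℂ) - x ≠ 0)
    (hint : Integrable (fun t : ℝ => 1 / ‖(t : ℂ) - x‖ ^ 2) σ) :
    NontangentialTendsto (fun z => (stieltjes σ z - stieltjes σ x) / (z - x)) x
      ((∫ t : ℝ, 1 / ‖(t : ℂ) - x‖ ^ 2 ∂σ : ℝ) : ℂ) := by
  intro θ hθ hθ'
  have hc : 0 < Real.cos θ := Real.cos_pos_of_mem_Ioo ⟨by linarith, hθ'⟩
  have hsec : ∀ᶠ z in 𝓝[sector x θ] (x : ℂ), z ∈ sector x θ := self_mem_nhdsWithin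
  have heq : ∀ᶠ z in 𝓝[sector x θ] (x : ℂ),
      ∫ t : ℝ, 1 / (((t : ℂ) - z) * ((t : ℂ) - x)) ∂σ
        = (stieltjes σ z - stieltjes σ x) / (z - x) := by
    filter_upwards [hsec] with z hz
    have hzx : z - x ≠ 0 := by
      intro h
      have := congrArg Complex.im h
      simp at this
      exact hz.1.ne' this
    rw [stieltjes, stieltjes, ← integral_sub (integrable_cauchyKernel hz.1)
      (integrable_cauchyKernel_of_sq hint), ← integral_div]
    apply integral_congr_ae
    filter_upwards [hae] with t ht
    have := ofReal_sub_ne_zero hz.1.ne' t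
    field_simp
    ring
  -- For real t and x, |t - x|² = (t - x)², so the derivative integral is the integral in the
  -- definition of an attracting point.
  have hlimval : ((∫ t : ℝ, 1 / ‖(t : ℂ) - x‖ ^ 2 ∂σ : ℝ) : ℂ)
      = ∫ t : ℝ, 1 / (((t : ℂ) - x) * ((t : ℂ) - x)) ∂σ := by
    rw [← integral_complex_ofReal]
    congr 1
    ext t
    have : ‖(t : ℂ) - x‖ ^ 2 = (t - x) * (t - x) := by
      rw [← Complex.ofReal_sub, Complex.norm_real, Real.norm_eq_abs, sq_abs, sq]
    rw [this]
    push_cast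
    rfl
  rw [hlimval]
  refine Tendsto.congr' heq ?_
  refine tendsto_integral_filter_of_dominated_convergence
    (fun t => (Real.cos θ)⁻¹ * (1 / ‖(t : ℂ) - x‖ ^ 2)) ?_ ?_ (hint.const_mul _) ?_
  · exact Eventually.of_forall fun z => Measurable.aestronglyMeasurable (by fun_prop)
  · filter_upwards [hsec] with z hz
    filter_upwards [hae] with t ht
    have h1 := sector_norm_sub_ge hθ hθ' hz t
    have h2 : 0 < ‖(t : ℂ) - x‖ := norm_pos_iff.2 ht
    rw [norm_div, norm_one, norm_mul, ← one_div, div_mul_div_comm, one_mul]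
    apply one_div_le_one_div_of_le (by positivity)
    nlinarith
  · filter_upwards [hae] with t ht
    apply tendsto_nhdsWithin_of_tendsto_nhds
    have : ContinuousAt (fun z : ℂ => 1 / (((t : ℂ) - z) * ((t : ℂ) - x))) x := by
      apply ContinuousAt.div (by fun_prop) (by fun_prop)
      exact mul_ne_zero ht ht
    exact this

theorem tendsto_stieltjes_vertical [IsFiniteMeasure σ] {x : ℝ}
    (hae : ∀ᵐ t : ℝ ∂σ, (t : ℂ) - x ≠ 0)
    (hint : Integrable (fun t : ℝ => 1 / ‖(t : ℂ) - x‖ ^ 2) σ) :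
    Tendsto (fun y : ℝ => stieltjes σ (x + y * Complex.I)) (𝓝[>] 0) (𝓝 (stieltjes σ x)) := by
  have h1 := nontangentialTendsto_slope_stieltjes hae hint (Real.pi / 4)
    (by linarith [Real.pi_pos]) (by linarith [Real.pi_pos])
  have h2 := h1.comp (tendsto_vertical_nhdsWithin_sector x (by linarith [Real.pi_pos]))
  have h3 : Tendsto (fun y : ℝ => (y : ℂ) * Complex.I) (𝓝[>] 0) (𝓝 0) := by
    apply tendsto_nhdsWithin_of_tendsto_nhds
    have : Continuous fun y : ℝ => (y : ℂ) * Complex.I := by fun_prop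
    simpa using this.tendsto 0
  have h4 := (h2.mul h3).add_const (stieltjes σ x)
  rw [mul_zero, zero_add] at h4
  refine h4.congr' ?_
  filter_upwards [self_mem_nhdsWithin] with y (hy : 0 < y)
  have : (y : ℂ) ≠ 0 := by exact_mod_cast hy.ne'
  simp only [Function.comp, add_sub_cancel_left]
  field_simp
  ring

/-- At an interior zero the imaginary part of the fixed point equation gives integral exactly 1. At
a real point the vertical limit of Q(z)/(z - x) bounds the integral, since its real part at x + iy
is ∫|t - x - iy|⁻² dσ - 1. -/
theorem IsGZNT.isAttractingFixedPoint [IsFiniteMeasure σ] {β : ℂ}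
    (h : IsGZNT (fun z => -z + stieltjes σ z) β) : IsAttractingFixedPoint σ β ∧ 0 ≤ β.im := by
  rcases h with ⟨him, h0⟩ | ⟨x, rfl, c, hc, hlim⟩
  · have hfix : stieltjes σ β = β := by
      linear_combination h0
    refine ⟨⟨ae_of_all _ (ofReal_sub_ne_zero him.ne'), integrable_cauchyKernel_sq him, ?_, hfix⟩,
      him.le⟩
    have h1 := im_stieltjes (σ := σ) him
    rw [hfix] at h1
    have : β.im * 1 = β.im * ∫ t : ℝ, 1 / ‖(t : ℂ) - β‖ ^ 2 ∂σ := by rw [← h1, mul_one]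
    exact (mul_left_cancel₀ him.ne' this).ge
  · have h1 := (hlim (Real.pi / 4) (by linarith [Real.pi_pos]) (by linarith [Real.pi_pos])).comp
      (tendsto_vertical_nhdsWithin_sector x (by linarith [Real.pi_pos]))
    have hbound : ∀ K : ℝ, 1 < K → ∀ᶠ y : ℝ in 𝓝[>] 0,
        ∫ t : ℝ, 1 / ‖(t : ℂ) - (x + y * Complex.I)‖ ^ 2 ∂σ ≤ K := by
      intro K hK
      have h2 := (Complex.continuous_re.tendsto _).comp h1
      rw [Complex.ofReal_re] at h2
      have h3 := h2.eventually (gt_mem_nhds (show c < K - 1 by linarith))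
      filter_upwards [h3, self_mem_nhdsWithin] with y hy (hy0 : 0 < y)
      have him : 0 < ((x : ℂ) + y * Complex.I).im := by simpa using hy0
      have h4 := im_stieltjes (σ := σ) him
      simp only [Function.comp, add_sub_cancel_left] at hy
      have h5 : ((-(x + y * Complex.I) + stieltjes σ (x + y * Complex.I)) / (y * Complex.I)).re
          = (stieltjes σ (x + y * Complex.I)).im / y - 1 := by
        set S := stieltjes σ (x + y * Complex.I)
        have e : (-((x : ℂ) + y * Complex.I) + S) / (y * Complex.I)
            = ((y⁻¹ : ℝ) : ℂ) * ((-((x : ℂ) + y * Complex.I) + S) * (-Complex.I)) := by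
          have : (y : ℂ) ≠ 0 := by exact_mod_cast hy0.ne'
          push_cast
          field_simp
          rw [Complex.I_sq]
          ring
        rw [e, Complex.re_ofReal_mul]
        simp
        field_simp
        ring
      rw [h5, h4] at hy
      simp at hy
      field_simp at hy
      exact hy.le
    obtain ⟨hi, hle⟩ := integrable_and_integral_le_one hbound
    have hae := ae_ne_of_integral_le ⟨2, hbound 2 (by norm_num)⟩
    refine ⟨⟨hae, hi, hle, ?_⟩, by simp⟩
    have h3 : Tendsto (fun y : ℝ => (y : ℂ) * Complex.I) (𝓝[>] 0) (𝓝 0) := by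
      apply tendsto_nhdsWithin_of_tendsto_nhds
      have : Continuous fun y : ℝ => (y : ℂ) * Complex.I := by fun_prop
      simpa using this.tendsto 0
    -- The transform at x + iy equals iy times the quotient plus x + iy, so it tends to x.
    have h4 := ((h1.mul h3).add (h3.const_add (x : ℂ)))
    rw [mul_zero, zero_add, add_zero] at h4
    refine tendsto_nhds_unique (tendsto_stieltjes_vertical hae hi) (h4.congr' ?_)
    filter_upwards [self_mem_nhdsWithin] with y (hy : 0 < y)
    have : (y : ℂ) ≠ 0 := by exact_mod_cast hy.ne'
    simp only [Function.comp, add_sub_cancel_left]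
    field_simp
    ring

/-- At an interior β take z = β. At a real β approach vertically: the inequality forces |F(x + iy) -
x| ≤ y, whence F(x) = x and the slope of F at x is at most 1. -/
theorem isGZNT_of_juliaInequality [IsFiniteMeasure σ] {β : ℂ} (hβ : 0 ≤ β.im)
    (h : ∀ z : ℂ, 0 < z.im → JuliaInequality (stieltjes σ) β z) :
    IsGZNT (fun z => -z + stieltjes σ z) β := by
  rcases hβ.lt_or_eq with him | him
  · left
    refine ⟨him, ?_⟩
    have h1 := h β him
    rw [JuliaInequality, sub_self, norm_zero] at h1
    have h2 : ‖stieltjes σ β - β‖ ^ 2 ≤ 0 := by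
      by_contra! hcon
      nlinarith
    have h3 : ‖stieltjes σ β - β‖ = 0 := by
      apply pow_eq_zero_iff (two_ne_zero) |>.1
      exact le_antisymm h2 (by positivity)
    have h4 := norm_eq_zero.1 h3
    linear_combination h4
  · right
    obtain ⟨x, rfl⟩ : ∃ x : ℝ, β = x := ⟨β.re, by apply Complex.ext <;> simp [him]⟩
    have hnorm : ∀ y : ℝ, 0 < y → ‖stieltjes σ (x + y * Complex.I) - x‖ ≤ y ∧
        ∫ t : ℝ, 1 / ‖(t : ℂ) - (x + y * Complex.I)‖ ^ 2 ∂σ ≤ 1 := by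
      intro y hy
      have him : 0 < ((x : ℂ) + y * Complex.I).im := by simpa using hy
      have h1 := h _ him
      have h4 := im_stieltjes (σ := σ) him
      have h5 := Complex.abs_im_le_norm (stieltjes σ (x + y * Complex.I) - x)
      rw [JuliaInequality, add_sub_cancel_left, norm_mul, Complex.norm_I, mul_one,
        Complex.norm_real, Real.norm_of_nonneg hy.le] at h1
      have hyim : ((x : ℂ) + y * Complex.I).im = y := by simp
      rw [hyim] at h1 h4
      simp only [Complex.sub_im, Complex.ofReal_im, sub_zero] at h5
      have h6 := (le_abs_self _).trans h5
      set n := ‖stieltjes σ (x + y * Complex.I) - x‖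
      have hn : n ≤ y := by
        -- Julia reads n²y ≤ y² Im F and Im F ≤ n, which gives n ≤ y.
        by_contra! hcon
        have h7 : n ^ 2 * y ≤ y ^ 2 * n := h1.trans (by gcongr)
        have h8 : 0 < n * y * (n - y) := by
          have := hy.trans hcon
          have := sub_pos.2 hcon
          positivity
        nlinarith
      refine ⟨hn, ?_⟩
      rw [h4] at h6
      by_contra! hcon
      nlinarith
    have hev : ∀ K : ℝ, 1 < K → ∀ᶠ y : ℝ in 𝓝[>] 0,
        ∫ t : ℝ, 1 / ‖(t : ℂ) - (x + y * Complex.I)‖ ^ 2 ∂σ ≤ K := by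
      intro K hK
      filter_upwards [self_mem_nhdsWithin] with y hy
      exact (hnorm y hy).2.trans hK.le
    obtain ⟨hi, hle⟩ := integrable_and_integral_le_one hev
    have hae := ae_ne_of_integral_le ⟨2, hev 2 (by norm_num)⟩
    have hfix : stieltjes σ x = x := by
      refine tendsto_nhds_unique (tendsto_stieltjes_vertical hae hi) ?_
      rw [tendsto_iff_norm_sub_tendsto_zero]
      refine squeeze_zero' (Eventually.of_forall fun y => norm_nonneg _)
        (g := fun y : ℝ => y) ?_ ?_
      · filter_upwards [self_mem_nhdsWithin] with y hy using (hnorm y hy).1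
      · exact tendsto_nhdsWithin_of_tendsto_nhds tendsto_id
    refine ⟨x, rfl, (∫ t : ℝ, 1 / ‖(t : ℂ) - x‖ ^ 2 ∂σ) - 1, by linarith, ?_⟩
    intro θ hθ hθ'
    have h1 := (nontangentialTendsto_slope_stieltjes hae hi θ hθ hθ').sub_const 1
    rw [Complex.ofReal_sub, Complex.ofReal_one]
    refine h1.congr' ?_
    have hsec : ∀ᶠ z in 𝓝[sector x θ] (x : ℂ), z ∈ sector x θ := self_mem_nhdsWithin
    filter_upwards [hsec] with z hz
    have hzx : z - x ≠ 0 := by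
      intro h
      have := congrArg Complex.im h
      simp at this
      exact hz.1.ne' this
    rw [hfix]
    field_simp
    ring

end Boundary

/-! ### Reduction of Julia's inequality to finitely many points -/

section Compactness

variable {σ : Measure ℝ}

/-- A small value of F high on the imaginary axis gives |F(iy) - β| ≤ |iy - β|/2, which fails for
large β. This confines the candidates to a compact set. -/
theorem norm_le_of_juliaInequality {F : ℂ → ℂ} {β : ℂ} {y : ℝ} (hy : 0 < y)
    (hF : ‖F (y * Complex.I)‖ ≤ y / 4) (h : JuliaInequality F β (y * Complex.I)) :
    ‖β‖ ≤ 2 * y := by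
  rw [JuliaInequality] at h
  have him : ((y : ℂ) * Complex.I).im = y := by simp
  rw [him] at h
  have h1 := (Complex.abs_im_le_norm (F (y * Complex.I))).trans hF
  have h2 := (le_abs_self _).trans h1
  have h3 : ‖F (y * Complex.I) - β‖ ^ 2 * y ≤ (‖(y : ℂ) * Complex.I - β‖ / 2) ^ 2 * y :=
    calc _ ≤ ‖(y : ℂ) * Complex.I - β‖ ^ 2 * (F (y * Complex.I)).im := h
      _ ≤ ‖(y : ℂ) * Complex.I - β‖ ^ 2 * (y / 4) := by gcongr
      _ = _ := by ring
  have h4 := le_of_sq_le_sq (le_of_mul_le_mul_right h3 hy) (by positivity)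
  have h5 : ‖(y : ℂ) * Complex.I - β‖ ≤ y + ‖β‖ := by
    refine (norm_sub_le _ _).trans ?_
    rw [norm_mul, Complex.norm_I, mul_one, Complex.norm_real, Real.norm_of_nonneg hy.le]
  have h6 : ‖β‖ ≤ ‖F (y * Complex.I) - β‖ + ‖F (y * Complex.I)‖ := by
    have := norm_sub_le (F (y * Complex.I)) (F (y * Complex.I) - β)
    rw [sub_sub_cancel] at this
    linarith
  linarith

/-- If an open set contains all points of the closed upper half-plane satisfying Julia's inequality
for the Stieltjes transform, then it contains all such points for functions which are close to the
Stieltjes transform at finitely many points. -/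
theorem exists_finset_juliaInequality [IsFiniteMeasure σ] {U : Set ℂ} (hU : IsOpen U)
    (h : ∀ β : ℂ, 0 ≤ β.im → (∀ z : ℂ, 0 < z.im → JuliaInequality (stieltjes σ) β z) → β ∈ U) :
    ∃ Z : Finset ℂ, (∀ z ∈ Z, 0 < z.im) ∧ ∃ δ : ℝ, 0 < δ ∧ ∀ (F : ℂ → ℂ) (β : ℂ), 0 ≤ β.im →
      (∀ z ∈ Z, ‖F z - stieltjes σ z‖ < δ) → (∀ z ∈ Z, JuliaInequality F β z) → β ∈ U := by
  set m := σ.real Set.univ with hm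
  have hm0 : 0 ≤ m := measureReal_nonneg
  -- Chosen so that m/y ≤ y/8; with an error of at most 1/8 ≤ y/8 this gives |F(iy)| ≤ y/4.
  set y : ℝ := 1 + 8 * m with hy
  have hy1 : 1 ≤ y := by linarith
  set K : Set ℂ := Metric.closedBall 0 (2 * y) ∩ {β : ℂ | 0 ≤ β.im} ∩ Uᶜ with hK
  have hKc : IsCompact K := by
    refine ((isCompact_closedBall _ _).inter_right ?_).inter_right hU.isClosed_compl
    exact isClosed_le continuous_const Complex.continuous_im
  obtain ⟨Z, hZ, δ, hδ, hmain⟩ : ∃ Z : Finset ℂ, (∀ z ∈ Z, 0 < z.im) ∧ ∃ δ : ℝ, 0 < δ ∧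
      ∀ (F : ℂ → ℂ), (∀ z ∈ Z, ‖F z - stieltjes σ z‖ < δ) → ∀ β ∈ K,
        ¬ (∀ z ∈ Z, JuliaInequality F β z) := by
    refine hKc.induction_on (p := fun S => ∃ Z : Finset ℂ, (∀ z ∈ Z, 0 < z.im) ∧ ∃ δ : ℝ, 0 < δ ∧
      ∀ (F : ℂ → ℂ), (∀ z ∈ Z, ‖F z - stieltjes σ z‖ < δ) → ∀ β ∈ S,
        ¬ (∀ z ∈ Z, JuliaInequality F β z)) ?_ ?_ ?_ ?_
    · exact ⟨∅, by simp, 1, one_pos, by simp⟩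
    · rintro S T hST ⟨Z, hZ, δ, hδ, H⟩
      exact ⟨Z, hZ, δ, hδ, fun F hF β hβ => H F hF β (hST hβ)⟩
    · rintro S T ⟨Z, hZ, δ, hδ, H⟩ ⟨Z', hZ', δ', hδ', H'⟩
      classical
      refine ⟨Z ∪ Z', ?_, min δ δ', lt_min hδ hδ', ?_⟩
      · intro z hz
        rcases Finset.mem_union.1 hz with hz | hz
        exacts [hZ z hz, hZ' z hz]
      · rintro F hF β (hβ | hβ) hJ
        · exact H F (fun z hz => (hF z (Finset.mem_union_left _ hz)).trans_le (min_le_left _ _)) β hβ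
            fun z hz => hJ z (Finset.mem_union_left _ hz)
        · exact H' F (fun z hz => (hF z (Finset.mem_union_right _ hz)).trans_le (min_le_right _ _))
            β hβ fun z hz => hJ z (Finset.mem_union_right _ hz)
    · rintro β ⟨⟨-, hβ⟩, hβU⟩
      obtain ⟨z, hz, hJ⟩ : ∃ z : ℂ, 0 < z.im ∧ ¬ JuliaInequality (stieltjes σ) β z := by
        by_contra! hcon
        exact hβU (h β hβ hcon)
      rw [JuliaInequality, not_le] at hJ
      -- Violating the inequality at a fixed z is an open condition on (F(z), β) jointly, so it
      -- persists near β for all F close to the transform at z.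
      have hopen : IsOpen {p : ℂ × ℂ | ‖z - p.2‖ ^ 2 * p.1.im < ‖p.1 - p.2‖ ^ 2 * z.im} :=
        isOpen_lt (by fun_prop) (by fun_prop)
      have hnhds : {p : ℂ × ℂ | ‖z - p.2‖ ^ 2 * p.1.im < ‖p.1 - p.2‖ ^ 2 * z.im}
          ∈ 𝓝 (stieltjes σ z, β) := hopen.mem_nhds hJ
      obtain ⟨δ, hδ, hball⟩ := Metric.mem_nhds_iff.1 hnhds
      refine ⟨Metric.ball β δ, mem_nhdsWithin_of_mem_nhds (Metric.ball_mem_nhds β hδ), {z},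
        by simpa using hz, δ, hδ, ?_⟩
      intro F hF β' hβ' hall
      have hmem : (F z, β') ∈ Metric.ball (stieltjes σ z, β) δ := by
        rw [Metric.mem_ball, Prod.dist_eq, max_lt_iff, dist_eq_norm]
        exact ⟨hF z (by simp), hβ'⟩
      have h1 : ‖z - β'‖ ^ 2 * (F z).im < ‖F z - β'‖ ^ 2 * z.im := hball hmem
      exact absurd (hall z (by simp)) (not_le.2 h1)
  classical
  refine ⟨insert ((y : ℂ) * Complex.I) Z, ?_, min δ (1 / 8), lt_min hδ (by norm_num), ?_⟩
  · intro z hz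
    rcases Finset.mem_insert.1 hz with rfl | hz
    · simp; linarith
    · exact hZ z hz
  · intro F β hβ hF hJ
    by_contra hβU
    refine hmain F (fun z hz => (hF z (Finset.mem_insert_of_mem hz)).trans_le (min_le_left _ _)) β
      ⟨⟨?_, hβ⟩, hβU⟩ fun z hz => hJ z (Finset.mem_insert_of_mem hz)
    rw [mem_closedBall_zero_iff]
    refine norm_le_of_juliaInequality (by linarith) ?_ (hJ _ (Finset.mem_insert_self _ _))
    have h1 := (hF _ (Finset.mem_insert_self ((y : ℂ) * Complex.I) Z)).le.trans (min_le_right _ _)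
    have him : ((y : ℂ) * Complex.I).im = y := by simp
    have h2 := norm_stieltjes_le (σ := σ) (z := (y : ℂ) * Complex.I) (by rw [him]; linarith)
    rw [him] at h2
    have h3 := norm_le_norm_add_norm_sub' (F (y * Complex.I)) (stieltjes σ (y * Complex.I))
    have h4 : y⁻¹ * m ≤ y / 8 := by
      rw [inv_mul_le_iff₀ (by linarith)]
      nlinarith
    linarith

end Compactness

/-! ### Second moments of linear and triangular quadratic forms -/

section Orthogonality

variable {Ω : Type*} {mΩ : MeasurableSpace Ω} {P : Measure Ω}

/-- One martingale step: the cross term is E[S̄Y]·E[X] = 0. Independence of X from S̄Y is assumed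
separately, as independence from Y alone does not give it. -/
theorem integral_norm_sq_add_mul [IsProbabilityMeasure P] {X S Y : Ω → ℂ} (hX : Measurable X)
    (hSm : Measurable S) (hYm : Measurable Y) (hind : IndepFun Y X P)
    (hind' : IndepFun (fun ω => star (S ω) * Y ω) X P) (hX2 : MemLp X 2 P) (hS2 : MemLp S 2 P)
    (hY2 : MemLp Y 2 P) (hX0 : ∫ ω, X ω ∂P = 0) :
    MemLp (fun ω => S ω + Y ω * X ω) 2 P ∧
      ∫ ω, ‖S ω + Y ω * X ω‖ ^ 2 ∂P
        = ∫ ω, ‖S ω‖ ^ 2 ∂P + (∫ ω, ‖Y ω‖ ^ 2 ∂P) * ∫ ω, ‖X ω‖ ^ 2 ∂P := by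
  have hXs : Integrable (fun ω => ‖X ω‖ ^ 2) P :=
    (memLp_two_iff_integrable_sq_norm hX.aestronglyMeasurable).1 hX2
  have hSs : Integrable (fun ω => ‖S ω‖ ^ 2) P :=
    (memLp_two_iff_integrable_sq_norm hSm.aestronglyMeasurable).1 hS2
  have hYs : Integrable (fun ω => ‖Y ω‖ ^ 2) P :=
    (memLp_two_iff_integrable_sq_norm hYm.aestronglyMeasurable).1 hY2
  have hYX : IndepFun (fun ω => ‖Y ω‖ ^ 2) (fun ω => ‖X ω‖ ^ 2) P :=
    hind.comp (φ := fun z => ‖z‖ ^ 2) (ψ := fun z => ‖z‖ ^ 2) (by fun_prop) (by fun_prop)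
  have hYXi : Integrable (fun ω => ‖Y ω‖ ^ 2 * ‖X ω‖ ^ 2) P := hYX.integrable_mul hYs hXs
  have hYX2 : MemLp (fun ω => Y ω * X ω) 2 P := by
    refine (memLp_two_iff_integrable_sq_norm (hYm.mul hX).aestronglyMeasurable).2 ?_
    simpa only [Pi.mul_apply, norm_mul, mul_pow] using hYXi
  refine ⟨hS2.add hYX2, ?_⟩
  have hSYi : Integrable (fun ω => star (S ω) * Y ω) P := hS2.star.integrable_mul hY2
  have hXi : Integrable X P := hX2.integrable (by norm_num)
  have hci : Integrable (fun ω => star (S ω) * Y ω * X ω) P :=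
    hind'.integrable_mul hSYi hXi
  have hc0 : ∫ ω, star (S ω) * Y ω * X ω ∂P = 0 := by
    rw [hind'.integral_fun_mul_eq_mul_integral hSYi.1 hXi.1, hX0, mul_zero]
  have hre : ∫ ω, (star (S ω) * Y ω * X ω).re ∂P = 0 := by
    have := integral_re (𝕜 := ℂ) hci
    rw [hc0] at this
    simpa using this
  have hpt : ∀ ω, ‖S ω + Y ω * X ω‖ ^ 2
      = ‖S ω‖ ^ 2 + ‖Y ω‖ ^ 2 * ‖X ω‖ ^ 2 + 2 * (star (S ω) * Y ω * X ω).re := by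
    intro ω
    rw [← mul_pow, ← norm_mul, mul_assoc]
    simp only [← Complex.normSq_eq_norm_sq, Complex.normSq_add]
    rw [← Complex.conj_re]
    simp
  simp only [hpt]
  have hrei : Integrable (fun ω => 2 * (star (S ω) * Y ω * X ω).re) P := (hci.re).const_mul 2
  have hsum : Integrable (fun ω => ‖S ω‖ ^ 2 + ‖Y ω‖ ^ 2 * ‖X ω‖ ^ 2) P := hSs.add hYXi
  rw [integral_add hsum hrei, integral_add hSs hYXi, integral_const_mul, hre,
    hYX.integral_fun_mul_eq_mul_integral hYs.1 hXs.1]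
  ring

/-- The σ-algebra generated by `X i`, `i < n`. -/
@[reducible]
noncomputable def pastSigmaAlgebra (X : ℕ → Ω → ℂ) (n : ℕ) : MeasurableSpace Ω :=
  ⨆ i ∈ Set.Iio n, MeasurableSpace.comap (X i) inferInstance

theorem measurable_pastSigmaAlgebra (X : ℕ → Ω → ℂ) {i n : ℕ} (h : i < n) :
    Measurable[pastSigmaAlgebra X n] (X i) :=
  (comap_measurable (X i)).mono
    (le_iSup₂ (f := fun i (_ : i ∈ Set.Iio n) => MeasurableSpace.comap (X i) inferInstance) i h)
    le_rfl

theorem pastSigmaAlgebra_mono (X : ℕ → Ω → ℂ) {m n : ℕ} (h : m ≤ n) :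
    pastSigmaAlgebra X m ≤ pastSigmaAlgebra X n :=
  biSup_mono fun _ hi => lt_of_lt_of_le hi h

variable {X : ℕ → Ω → ℂ}

theorem pastSigmaAlgebra_le (hX : ∀ i, Measurable (X i)) (n : ℕ) : pastSigmaAlgebra X n ≤ mΩ :=
  iSup₂_le fun i _ => (hX i).comap_le

theorem indep_pastSigmaAlgebra (hX : ∀ i, Measurable (X i)) (hind : iIndepFun X P) (n : ℕ) :
    Indep (pastSigmaAlgebra X n) (MeasurableSpace.comap (X n) inferInstance) P := by
  have h := indep_iSup_of_disjoint (fun i => (hX i).comap_le) hind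
    (S := Set.Iio n) (T := {n}) (by simp)
  simpa [pastSigmaAlgebra] using h

/-- Martingale transforms of independent centred square-integrable variables. -/
theorem integral_norm_sq_sum_mul [IsProbabilityMeasure P]
    (hX : ∀ i, Measurable (X i)) (hind : iIndepFun X P)
    (hX2 : ∀ i, MemLp (X i) 2 P) (hX0 : ∀ i, ∫ ω, X i ω ∂P = 0) {Y : ℕ → Ω → ℂ}
    (hY : ∀ i, Measurable[pastSigmaAlgebra X i] (Y i)) (hY2 : ∀ i, MemLp (Y i) 2 P) (n : ℕ) :
    MemLp (fun ω => ∑ j ∈ Finset.range n, Y j ω * X j ω) 2 P ∧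
      ∫ ω, ‖∑ j ∈ Finset.range n, Y j ω * X j ω‖ ^ 2 ∂P
        = ∑ j ∈ Finset.range n, (∫ ω, ‖Y j ω‖ ^ 2 ∂P) * ∫ ω, ‖X j ω‖ ^ 2 ∂P := by
  induction n with
  | zero => simp
  | succ n ih =>
    simp only [Finset.sum_range_succ]
    rw [← ih.2]
    -- The partial sum depends only on the past, so X n is independent of it and of its products
    -- with Y n.
    have hS : Measurable[pastSigmaAlgebra X n] fun ω => ∑ j ∈ Finset.range n, Y j ω * X j ω := by
      refine Finset.measurable_fun_sum _ fun j hj => ?_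
      have hjn := Finset.mem_range.1 hj
      exact ((hY j).mono (pastSigmaAlgebra_mono X hjn.le) le_rfl).mul
        (measurable_pastSigmaAlgebra X hjn)
    have hle := pastSigmaAlgebra_le hX n
    have hindF : ∀ Z : Ω → ℂ, Measurable[pastSigmaAlgebra X n] Z → IndepFun Z (X n) P :=
      fun Z hZ => (IndepFun_iff_Indep _ _ _).2
        (indep_of_indep_of_le_left (indep_pastSigmaAlgebra hX hind n) hZ.comap_le)
    exact integral_norm_sq_add_mul (hX n) (hS.mono hle le_rfl) ((hY n).mono hle le_rfl)
      (hindF _ (hY n)) (hindF _ ((continuous_star.measurable.comp hS).mul (hY n)))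
      (hX2 n) ih.1 (hY2 n) (hX0 n)

theorem integral_norm_sq_sum_const_mul [IsProbabilityMeasure P]
    (hX : ∀ i, Measurable (X i)) (hind : iIndepFun X P)
    (hX2 : ∀ i, MemLp (X i) 2 P) (hX0 : ∀ i, ∫ ω, X i ω ∂P = 0) (c : ℕ → ℂ) (n : ℕ) :
    MemLp (fun ω => ∑ j ∈ Finset.range n, c j * X j ω) 2 P ∧
      ∫ ω, ‖∑ j ∈ Finset.range n, c j * X j ω‖ ^ 2 ∂P
        = ∑ j ∈ Finset.range n, ‖c j‖ ^ 2 * ∫ ω, ‖X j ω‖ ^ 2 ∂P := by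
  have h := integral_norm_sq_sum_mul hX hind hX2 hX0 (Y := fun j _ => c j)
    (fun _ => measurable_const) (fun _ => memLp_const _) n
  simpa using h

theorem iIndepFun_star (hind : iIndepFun X P) : iIndepFun (fun i ω => star (X i ω)) P :=
  hind.comp (fun _ z => star z) fun _ => continuous_star.measurable

theorem integral_star_eq_zero (hX0 : ∀ i, ∫ ω, X i ω ∂P = 0) (i : ℕ) :
    ∫ ω, star (X i ω) ∂P = 0 := by
  have := integral_conj (𝕜 := ℂ) (μ := P) (f := X i)
  rw [hX0 i, map_zero] at this
  exact this

/-- The second moment of the strictly upper triangular part of a quadratic form. -/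
theorem integral_norm_sq_triangular [IsProbabilityMeasure P]
    (hX : ∀ i, Measurable (X i)) (hind : iIndepFun X P)
    (hX2 : ∀ i, MemLp (X i) 2 P) (hX0 : ∀ i, ∫ ω, X i ω ∂P = 0) {v : ℝ}
    (hv : ∀ i, ∫ ω, ‖X i ω‖ ^ 2 ∂P = v) (A : ℕ → ℕ → ℂ) (n : ℕ) :
    MemLp (fun ω => ∑ j ∈ Finset.range n,
      (∑ i ∈ Finset.range j, A i j * star (X i ω)) * X j ω) 2 P ∧
      ∫ ω, ‖∑ j ∈ Finset.range n, (∑ i ∈ Finset.range j, A i j * star (X i ω)) * X j ω‖ ^ 2 ∂P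
        = ∑ j ∈ Finset.range n, ∑ i ∈ Finset.range j, ‖A i j‖ ^ 2 * v ^ 2 := by
  have hY := fun j => integral_norm_sq_sum_const_mul (P := P) (X := fun i ω => star (X i ω))
    (fun i => continuous_star.measurable.comp (hX i)) (iIndepFun_star hind)
    (fun i => (hX2 i).star) (integral_star_eq_zero hX0) (fun i => A i j) j
  have h := integral_norm_sq_sum_mul hX hind hX2 hX0
    (Y := fun j ω => ∑ i ∈ Finset.range j, A i j * star (X i ω)) (fun j => by
      refine Finset.measurable_fun_sum _ fun i hi => Measurable.const_mul ?_ _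
      exact continuous_star.measurable.comp
        (measurable_pastSigmaAlgebra X (Finset.mem_range.1 hi))) (fun j => (hY j).1) n
  refine ⟨h.1, h.2.trans ?_⟩
  refine Finset.sum_congr rfl fun j _ => ?_
  rw [(hY j).2, hv, Finset.sum_mul]
  refine Finset.sum_congr rfl fun i _ => ?_
  simp only [norm_star, hv]
  ring

/-- From |f| ≤ c + |f|²/c. Taking c proportional to n turns a second moment of order n into a small
multiple of n plus a constant. -/
theorem integral_norm_le_of_integral_sq_le [IsProbabilityMeasure P] {f : Ω → ℂ}
    (hf : MemLp f 2 P) {B c : ℝ} (hc : 0 < c)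
    (h : ∫ ω, ‖f ω‖ ^ 2 ∂P ≤ B) : ∫ ω, ‖f ω‖ ∂P ≤ c + B / c := by
  have hfi : Integrable f P := hf.integrable (by norm_num)
  have hfs : Integrable (fun ω => ‖f ω‖ ^ 2) P := (memLp_two_iff_integrable_sq_norm hf.1).1 hf
  have h1 : ∫ ω, ‖f ω‖ ∂P ≤ ∫ ω, (c + ‖f ω‖ ^ 2 / c) ∂P := by
    refine integral_mono hfi.norm ((integrable_const c).add (hfs.div_const c)) fun ω => ?_
    have : c * ‖f ω‖ ≤ c * (c + ‖f ω‖ ^ 2 / c) := by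
      field_simp
      nlinarith [sq_nonneg (c - ‖f ω‖), norm_nonneg (f ω)]
    exact le_of_mul_le_mul_left this hc
  rw [integral_add (integrable_const c) (hfs.div_const c), integral_div] at h1
  simp only [integral_const, probReal_univ, one_smul] at h1
  have : (∫ ω, ‖f ω‖ ^ 2 ∂P) / c ≤ B / c := by gcongr
  linarith

/-- The two triangular parts are martingale transforms, in w and in its conjugate. Only the diagonal
needs a law of large numbers. -/
theorem quadraticForm_decomposition (w : ℕ → ℂ) (A : ℕ → ℕ → ℂ) (n : ℕ) :
    ∑ i ∈ Finset.range n, ∑ j ∈ Finset.range n, star (w i) * A i j * w j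
      = ∑ j ∈ Finset.range n, (∑ i ∈ Finset.range j, A i j * star (w i)) * w j
        + ∑ j ∈ Finset.range n, (∑ i ∈ Finset.range j, A j i * w i) * star (w j)
        + ∑ j ∈ Finset.range n, A j j * ((‖w j‖ ^ 2 : ℝ) : ℂ) := by
  induction n with
  | zero => simp
  | succ n ih =>
    simp only [Finset.sum_range_succ, Finset.sum_add_distrib] at ih ⊢
    rw [ih]
    have e1 : ∑ i ∈ Finset.range n, star (w i) * A i n * w n
        = (∑ i ∈ Finset.range n, A i n * star (w i)) * w n := by
      rw [Finset.sum_mul]; exact Finset.sum_congr rfl fun i _ => by ring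
    have e2 : ∑ i ∈ Finset.range n, star (w n) * A n i * w i
        = (∑ i ∈ Finset.range n, A n i * w i) * star (w n) := by
      rw [Finset.sum_mul]; exact Finset.sum_congr rfl fun i _ => by ring
    have e3 : star (w n) * A n n * w n = A n n * ((‖w n‖ ^ 2 : ℝ) : ℂ) := by
      have := Complex.conj_mul' (w n)
      push_cast
      rw [← this]
      change (starRingEnd ℂ) (w n) * A n n * w n = _
      ring
    rw [e1, e2, e3]
    ring

end Orthogonality

/-! ### L¹ concentration of quadratic forms -/

section Concentration

variable {Ω : Type*} {mΩ : MeasurableSpace Ω} {P : Measure Ω} {X : ℕ → Ω → ℂ}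

theorem sum_triangle_le {B : ℕ → ℕ → ℝ} (hB : ∀ i j, 0 ≤ B i j) (n : ℕ) :
    ∑ j ∈ Finset.range n, ∑ i ∈ Finset.range j, B i j
      ≤ ∑ i ∈ Finset.range n, ∑ j ∈ Finset.range n, B i j := by
  rw [Finset.sum_comm (s := Finset.range n) (t := Finset.range n)]
  refine Finset.sum_le_sum fun j hj => ?_
  exact Finset.sum_le_sum_of_subset_of_nonneg
    (Finset.range_subset_range.2 (Finset.mem_range.1 hj).le) fun i _ _ => hB i j

theorem exists_integral_norm_sq_tail_le {Y : Ω → ℂ} (hY : Measurable Y) (hY2 : MemLp Y 2 P) {τ : ℝ}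
    (hτ : 0 < τ) : ∃ M : ℝ, 0 < M ∧
      ∫ ω, {w : ℂ | M < ‖w‖}.indicator (fun w => ‖w‖ ^ 2) (Y ω) ∂P ≤ τ := by
  have hs : Integrable (fun ω => ‖Y ω‖ ^ 2) P := (memLp_two_iff_integrable_sq_norm hY2.1).1 hY2
  have hmeas : ∀ M : ℝ, Measurable ({w : ℂ | M < ‖w‖}.indicator fun w : ℂ => ‖w‖ ^ 2) := fun M =>
    Measurable.indicator (by fun_prop) (measurableSet_lt measurable_const measurable_norm)
  have hlim : Tendsto (fun M : ℝ =>
      ∫ ω, {w : ℂ | M < ‖w‖}.indicator (fun w => ‖w‖ ^ 2) (Y ω) ∂P) atTop (𝓝 (∫ ω, 0 ∂P)) := by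
    refine tendsto_integral_filter_of_dominated_convergence (fun ω => ‖Y ω‖ ^ 2) ?_ ?_ hs ?_
    · exact Eventually.of_forall fun M => ((hmeas M).comp hY).aestronglyMeasurable
    · refine Eventually.of_forall fun M => ae_of_all _ fun ω => ?_
      rw [Real.norm_of_nonneg (Set.indicator_nonneg (fun w _ => by positivity) _)]
      exact Set.indicator_le_self' (fun w _ => by positivity) _
    · refine ae_of_all _ fun ω => tendsto_const_nhds.congr' ?_
      filter_upwards [eventually_ge_atTop ‖Y ω‖] with M hM
      rw [Set.indicator_of_notMem]
      simpa using hM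
  rw [integral_zero] at hlim
  obtain ⟨M, h1, h2⟩ := ((hlim.eventually (gt_mem_nhds hτ)).and (eventually_gt_atTop 0)).exists
  exact ⟨M, h2, h1.le⟩

/-- A weighted weak law of large numbers for the squared norms. -/
theorem exists_integral_norm_diagonal_le [IsProbabilityMeasure P]
    (hX : ∀ i, Measurable (X i)) (hind : iIndepFun X P)
    (hident : ∀ i, IdentDistrib (X i) (X 0) P P) (hX2 : MemLp (X 0) 2 P) {v : ℝ}
    (hv : ∫ ω, ‖X 0 ω‖ ^ 2 ∂P = v) {K ρ : ℝ} (hK : 0 < K) (hρ : 0 < ρ) :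
    ∃ L : ℝ, 0 ≤ L ∧ ∀ (n : ℕ) (c : ℕ → ℂ), 0 < n → (∀ i < n, ‖c i‖ ≤ K) →
      Integrable (fun ω => ∑ j ∈ Finset.range n, c j * ((‖X j ω‖ ^ 2 - v : ℝ) : ℂ)) P ∧
      ∫ ω, ‖∑ j ∈ Finset.range n, c j * ((‖X j ω‖ ^ 2 - v : ℝ) : ℂ)‖ ∂P ≤ ρ * n + L := by
  -- The tail will cost at most K·2τ per index, so τ = ρ/(4K) spends half of ρ.
  obtain ⟨M, hM, htail⟩ := exists_integral_norm_sq_tail_le (hX 0) hX2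
    (τ := ρ / (4 * K)) (by positivity)
  -- Truncation |w|² = φ + ψ with φ bounded by M². The centred φ part is handled in L², the ψ part
  -- in L¹, so no fourth moment is needed.
  set ψ : ℂ → ℝ := {w : ℂ | M < ‖w‖}.indicator fun w => ‖w‖ ^ 2 with hψ
  set φ : ℂ → ℝ := fun w => ‖w‖ ^ 2 - ψ w with hφ
  have hψm : Measurable ψ :=
    Measurable.indicator (by fun_prop) (measurableSet_lt measurable_const measurable_norm)
  have hφm : Measurable φ := by fun_prop
  have hψ0 : ∀ w, 0 ≤ ψ w := fun w => Set.indicator_nonneg (fun w _ => by positivity) _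
  have hφb : ∀ w, |φ w| ≤ M ^ 2 := by
    intro w
    by_cases hw : M < ‖w‖
    · have : φ w = 0 := by
        simp only [hφ, hψ]
        rw [Set.indicator_of_mem (by exact hw)]; ring
      rw [this, abs_zero]; positivity
    · have : φ w = ‖w‖ ^ 2 := by
        simp only [hφ, hψ]
        rw [Set.indicator_of_notMem (by exact hw)]; ring
      rw [this, abs_of_nonneg (by positivity)]
      push Not at hw
      gcongr
  have hXi2 : ∀ i, MemLp (X i) 2 P := fun i => (hident i).symm.memLp_snd hX2
  have hsq : ∀ i, Integrable (fun ω => ‖X i ω‖ ^ 2) P := fun i =>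
    (memLp_two_iff_integrable_sq_norm (hX i).aestronglyMeasurable).1 (hXi2 i)
  have hφi : ∀ i, Integrable (fun ω => φ (X i ω)) P := fun i =>
    Integrable.of_bound (hφm.comp (hX i)).aestronglyMeasurable (M ^ 2)
      (ae_of_all _ fun ω => by simpa using hφb (X i ω))
  have hψi : ∀ i, Integrable (fun ω => ψ (X i ω)) P := fun i => by
    have := (hsq i).sub (hφi i)
    refine this.congr (ae_of_all _ fun ω => ?_)
    simp [hφ]
  set e := ∫ ω, φ (X 0 ω) ∂P with he
  set τ := ∫ ω, ψ (X 0 ω) ∂P with hτ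
  have heτ : v = e + τ := by
    rw [he, hτ, ← integral_add (hφi 0) (hψi 0), ← hv]
    congr 1; ext ω; simp [hφ]
  have hφe : ∀ i, ∫ ω, φ (X i ω) ∂P = e := fun i => ((hident i).comp hφm).integral_eq
  have hψτ : ∀ i, ∫ ω, ψ (X i ω) ∂P = τ := fun i => ((hident i).comp hψm).integral_eq
  have hτ0 : 0 ≤ τ := integral_nonneg fun ω => hψ0 _
  have heb : |e| ≤ M ^ 2 := by
    have := norm_integral_le_of_norm_le_const (μ := P) (f := fun ω => φ (X 0 ω)) (C := M ^ 2)
      (ae_of_all _ fun ω => by simpa using hφb (X 0 ω))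
    simpa using this
  set Y : ℕ → Ω → ℂ := fun i ω => ((φ (X i ω) - e : ℝ) : ℂ) with hY
  have hYm : ∀ i, Measurable (Y i) := fun i =>
    Complex.measurable_ofReal.comp ((hφm.comp (hX i)).sub_const e)
  have hYind : iIndepFun Y P :=
    hind.comp (fun _ w => ((φ w - e : ℝ) : ℂ)) fun _ =>
      Complex.measurable_ofReal.comp (hφm.sub_const e)
  have hYb : ∀ i ω, ‖Y i ω‖ ≤ 2 * M ^ 2 := by
    intro i ω
    rw [hY, Complex.norm_real, Real.norm_eq_abs]
    have := abs_sub (φ (X i ω)) e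
    have := hφb (X i ω)
    linarith
  have hY2 : ∀ i, MemLp (Y i) 2 P := fun i =>
    MemLp.of_bound (hYm i).aestronglyMeasurable (2 * M ^ 2) (ae_of_all _ (hYb i))
  have hY0 : ∀ i, ∫ ω, Y i ω ∂P = 0 := by
    intro i
    simp only [hY]
    rw [integral_complex_ofReal, integral_sub (hφi i) (integrable_const e), hφe]
    simp
  have hYsq : ∀ i, ∫ ω, ‖Y i ω‖ ^ 2 ∂P ≤ (2 * M ^ 2) ^ 2 := by
    intro i
    have h1 : ∫ ω, ‖Y i ω‖ ^ 2 ∂P ≤ ∫ _, (2 * M ^ 2) ^ 2 ∂P := by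
      refine integral_mono ((memLp_two_iff_integrable_sq_norm (hYm i).aestronglyMeasurable).1
        (hY2 i)) (integrable_const _) fun ω => ?_
      have := hYb i ω
      exact pow_le_pow_left₀ (norm_nonneg _) this 2
    simpa using h1
  -- This is B/c for B = nK²(2M²)² and c = ρn/2, in which n cancels.
  refine ⟨K ^ 2 * (2 * M ^ 2) ^ 2 / (ρ / 2), by positivity, fun n c hn hc => ?_⟩
  have hSY := integral_norm_sq_sum_const_mul hYm hYind hY2 hY0 c n
  have hSYle : ∫ ω, ‖∑ j ∈ Finset.range n, c j * Y j ω‖ ^ 2 ∂P ≤ n * (K ^ 2 * (2 * M ^ 2) ^ 2) := by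
    rw [hSY.2]
    calc _ ≤ ∑ j ∈ Finset.range n, K ^ 2 * (2 * M ^ 2) ^ 2 := by
          refine Finset.sum_le_sum fun j hj => ?_
          have := hc j (Finset.mem_range.1 hj)
          have := hYsq j
          gcongr
      _ = _ := by simp
  have hn' : (0 : ℝ) < n := by exact_mod_cast hn
  have hA := integral_norm_le_of_integral_sq_le hSY.1 (c := ρ / 2 * n) (by positivity) hSYle
  have hSYi : Integrable (fun ω => ∑ j ∈ Finset.range n, c j * Y j ω) P :=
    hSY.1.integrable (by norm_num)
  have hZi : ∀ j, Integrable (fun ω => ((ψ (X j ω) - τ : ℝ) : ℂ)) P := fun j =>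
    ((hψi j).sub (integrable_const τ)).ofReal
  have hSZi : Integrable (fun ω => ∑ j ∈ Finset.range n, c j * ((ψ (X j ω) - τ : ℝ) : ℂ)) P :=
    integrable_finsetSum _ fun j _ => (hZi j).const_mul (c j)
  have hsplit : ∀ ω, ∑ j ∈ Finset.range n, c j * ((‖X j ω‖ ^ 2 - v : ℝ) : ℂ)
      = ∑ j ∈ Finset.range n, c j * Y j ω
        + ∑ j ∈ Finset.range n, c j * ((ψ (X j ω) - τ : ℝ) : ℂ) := by
    intro ω
    rw [← Finset.sum_add_distrib]
    refine Finset.sum_congr rfl fun j _ => ?_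
    rw [← mul_add, hY, ← Complex.ofReal_add]
    congr 3
    simp only [hφ]
    rw [heτ]; ring
  have hB : ∫ ω, ‖∑ j ∈ Finset.range n, c j * ((ψ (X j ω) - τ : ℝ) : ℂ)‖ ∂P ≤ ρ / 2 * n := by
    have hbi : ∀ j, Integrable (fun ω => K * (ψ (X j ω) + τ)) P := fun j =>
      ((hψi j).add (integrable_const τ)).const_mul K
    calc _ ≤ ∫ ω, ∑ j ∈ Finset.range n, K * (ψ (X j ω) + τ) ∂P := by
          refine integral_mono hSZi.norm (integrable_finsetSum _ fun j _ => hbi j) fun ω => ?_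
          refine (norm_sum_le _ _).trans (Finset.sum_le_sum fun j hj => ?_)
          rw [norm_mul, Complex.norm_real, Real.norm_eq_abs]
          have h1 := hc j (Finset.mem_range.1 hj)
          have h2 : |ψ (X j ω) - τ| ≤ ψ (X j ω) + τ := by
            have := hψ0 (X j ω)
            rw [abs_le]; constructor <;> linarith
          gcongr
      _ = ∑ j ∈ Finset.range n, K * (τ + τ) := by
          rw [integral_finsetSum _ fun j _ => hbi j]
          refine Finset.sum_congr rfl fun j _ => ?_
          rw [integral_const_mul, integral_add (hψi j) (integrable_const τ), hψτ]
          simp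
      _ = n * (K * (τ + τ)) := by simp
      _ ≤ n * (ρ / 2) := by
          gcongr
          have : K * (τ + τ) ≤ K * (ρ / (4 * K) + ρ / (4 * K)) := by gcongr
          refine this.trans (le_of_eq ?_)
          field_simp
          ring
      _ = _ := by ring
  simp only [hsplit]
  refine ⟨hSYi.add hSZi, ?_⟩
  calc _ ≤ ∫ ω, (‖∑ j ∈ Finset.range n, c j * Y j ω‖
        + ‖∑ j ∈ Finset.range n, c j * ((ψ (X j ω) - τ : ℝ) : ℂ)‖) ∂P :=
        integral_mono (hSYi.add hSZi).norm (hSYi.norm.add hSZi.norm) fun ω => norm_add_le _ _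
    _ ≤ _ := by
        rw [integral_add hSYi.norm hSZi.norm]
        have : (n : ℝ) * (K ^ 2 * (2 * M ^ 2) ^ 2) / (ρ / 2 * n)
          = K ^ 2 * (2 * M ^ 2) ^ 2 / (ρ / 2) := by field_simp
        rw [this] at hA
        linarith

/-- Concentration of quadratic forms in `L¹`, uniformly in the coefficients. -/
theorem exists_integral_norm_quadraticForm_le [IsProbabilityMeasure P]
    (hX : ∀ i, Measurable (X i)) (hind : iIndepFun X P)
    (hident : ∀ i, IdentDistrib (X i) (X 0) P P) (hX2 : MemLp (X 0) 2 P)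
    (hX0 : ∫ ω, X 0 ω ∂P = 0) {v : ℝ}
    (hv : ∫ ω, ‖X 0 ω‖ ^ 2 ∂P = v) {K ρ : ℝ} (hK : 0 < K) (hρ : 0 < ρ) :
    ∃ n₀ : ℕ, ∀ n ≥ n₀, ∀ A : ℕ → ℕ → ℂ, (∀ i < n, ‖A i i‖ ≤ K) →
      (∑ i ∈ Finset.range n, ∑ j ∈ Finset.range n, ‖A i j‖ ^ 2 ≤ n * K ^ 2) →
      Integrable (fun ω => ∑ i ∈ Finset.range n, ∑ j ∈ Finset.range n,
        star (X i ω) * A i j * X j ω - v * ∑ i ∈ Finset.range n, A i i) P ∧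
      ∫ ω, ‖∑ i ∈ Finset.range n, ∑ j ∈ Finset.range n,
        star (X i ω) * A i j * X j ω - v * ∑ i ∈ Finset.range n, A i i‖ ∂P ≤ ρ * n := by
  have hXi2 : ∀ i, MemLp (X i) 2 P := fun i => (hident i).symm.memLp_snd hX2
  have hXi0 : ∀ i, ∫ ω, X i ω ∂P = 0 := fun i => (hident i).integral_eq.trans hX0
  have hXv : ∀ i, ∫ ω, ‖X i ω‖ ^ 2 ∂P = v := fun i =>
    ((hident i).comp (u := fun w : ℂ => ‖w‖ ^ 2) (by fun_prop)).integral_eq.trans hv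
  obtain ⟨L, hL, hdiag⟩ := exists_integral_norm_diagonal_le hX hind hident hX2 hv hK
    (ρ := ρ / 4) (by positivity)
  set L' := v ^ 2 * K ^ 2 / (ρ / 4) with hL'
  -- The diagonal and the two triangles each cost ρn/4 plus a constant; the last quarter absorbs the
  -- constants for large n.
  obtain ⟨n₀, hn₀⟩ := exists_nat_ge ((L + L' + L') / (ρ / 4))
  refine ⟨n₀ + 1, fun n hn A hA hAs => ?_⟩
  have hn0 : 0 < n := by omega
  have hn' : (0 : ℝ) < n := by exact_mod_cast hn0
  have hnL : L + L' + L' ≤ ρ / 4 * n := by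
    rw [div_le_iff₀ (by positivity)] at hn₀
    have : (n₀ : ℝ) ≤ n := by exact_mod_cast (by omega : n₀ ≤ n)
    nlinarith
  have hU := integral_norm_sq_triangular hX hind hXi2 hXi0 hXv A n
  have hW := integral_norm_sq_triangular (P := P) (X := fun i ω => star (X i ω))
    (fun i => continuous_star.measurable.comp (hX i)) (iIndepFun_star hind)
    (fun i => (hXi2 i).star) (integral_star_eq_zero hXi0) (v := v)
    (fun i => by simpa only [norm_star] using hXv i) (fun i j => A j i) n
  simp only [star_star] at hW
  have hUle : ∫ ω, ‖∑ j ∈ Finset.range n, (∑ i ∈ Finset.range j, A i j * star (X i ω)) * X j ω‖ ^ 2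
      ∂P ≤ n * (v ^ 2 * K ^ 2) := by
    rw [hU.2]
    simp only [← Finset.sum_mul]
    have h1 := (sum_triangle_le (B := fun i j => ‖A i j‖ ^ 2) (fun i j => by positivity) n).trans hAs
    nlinarith [sq_nonneg v]
  have hWle : ∫ ω, ‖∑ j ∈ Finset.range n, (∑ i ∈ Finset.range j, A j i * X i ω) * star (X j ω)‖ ^ 2
      ∂P ≤ n * (v ^ 2 * K ^ 2) := by
    rw [hW.2]
    simp only [← Finset.sum_mul]
    rw [Finset.sum_comm] at hAs
    have h1 := (sum_triangle_le (B := fun i j => ‖A j i‖ ^ 2) (fun i j => by positivity) n).trans hAs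
    nlinarith [sq_nonneg v]
  have hUn := integral_norm_le_of_integral_sq_le hU.1 (c := ρ / 4 * n) (by positivity) hUle
  have hWn := integral_norm_le_of_integral_sq_le hW.1 (c := ρ / 4 * n) (by positivity) hWle
  have hconst : (n : ℝ) * (v ^ 2 * K ^ 2) / (ρ / 4 * n) = L' := by
    rw [hL']; field_simp
  rw [hconst] at hUn hWn
  obtain ⟨hDi, hDn⟩ := hdiag n (fun i => A i i) hn0 hA
  have hUi := hU.1.integrable (show (1 : ENNReal) ≤ 2 by norm_num)
  have hWi := hW.1.integrable (show (1 : ENNReal) ≤ 2 by norm_num)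
  have hsplit : ∀ ω, ∑ i ∈ Finset.range n, ∑ j ∈ Finset.range n,
        star (X i ω) * A i j * X j ω - v * ∑ i ∈ Finset.range n, A i i
      = ∑ j ∈ Finset.range n, (∑ i ∈ Finset.range j, A i j * star (X i ω)) * X j ω
        + ∑ j ∈ Finset.range n, (∑ i ∈ Finset.range j, A j i * X i ω) * star (X j ω)
        + ∑ j ∈ Finset.range n, A j j * ((‖X j ω‖ ^ 2 - v : ℝ) : ℂ) := by
    intro ω
    rw [quadraticForm_decomposition (fun i => X i ω) A n, add_sub_assoc, Finset.mul_sum,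
      ← Finset.sum_sub_distrib]
    congr 1
    refine Finset.sum_congr rfl fun j _ => ?_
    push_cast
    ring
  simp only [hsplit]
  have hUWi := hUi.add hWi
  refine ⟨hUWi.add hDi, ?_⟩
  calc _ ≤ ∫ ω, (‖∑ j ∈ Finset.range n, (∑ i ∈ Finset.range j, A i j * star (X i ω)) * X j ω‖
        + ‖∑ j ∈ Finset.range n, (∑ i ∈ Finset.range j, A j i * X i ω) * star (X j ω)‖
        + ‖∑ j ∈ Finset.range n, A j j * ((‖X j ω‖ ^ 2 - v : ℝ) : ℂ)‖) ∂P :=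
        integral_mono (hUWi.add hDi).norm ((hUi.norm.add hWi.norm).add hDi.norm)
          fun ω => norm_add₃_le
    _ ≤ _ := by
        have hUWn : Integrable (fun ω =>
          ‖∑ j ∈ Finset.range n, (∑ i ∈ Finset.range j, A i j * star (X i ω)) * X j ω‖
          + ‖∑ j ∈ Finset.range n, (∑ i ∈ Finset.range j, A j i * X i ω) * star (X j ω)‖) P :=
          hUi.norm.add hWi.norm
        rw [integral_add hUWn hDi.norm, integral_add hUi.norm hWi.norm]
        linarith

end Concentration

/-! ### Quadratic forms of random resolvents -/

section Resolvents

open Matrix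

variable {Ω : Type*} {mΩ : MeasurableSpace Ω} {P : Measure Ω} [IsProbabilityMeasure P]

/-- A bound on the conditional probabilities given an independent variable is a bound on the
probability. -/
theorem measure_le_of_indepFun {α γ : Type*} [MeasurableSpace α] [MeasurableSpace γ] {X : Ω → α}
    {Y : Ω → γ} (hX : Measurable X) (hY : Measurable Y) (h : IndepFun X Y P) {S : Set (α × γ)}
    (hS : MeasurableSet S) {η : ENNReal} (hη : ∀ ω, P {ω' | (X ω', Y ω) ∈ S} ≤ η) :
    P {ω | (X ω, Y ω) ∈ S} ≤ η := by
  have hmap := (indepFun_iff_map_prod_eq_prod_map_map hX.aemeasurable hY.aemeasurable).1 h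
  have : IsProbabilityMeasure (P.map X) := Measure.isProbabilityMeasure_map hX.aemeasurable
  have : IsProbabilityMeasure (P.map Y) := Measure.isProbabilityMeasure_map hY.aemeasurable
  calc P {ω | (X ω, Y ω) ∈ S} = P.map (fun ω => (X ω, Y ω)) S :=
        (Measure.map_apply (hX.prodMk hY) hS).symm
    _ = ∫⁻ y, P.map X ((fun x => (x, y)) ⁻¹' S) ∂(P.map Y) := by
        rw [hmap, Measure.prod_apply_symm hS]
    _ = ∫⁻ ω, P.map X ((fun x => (x, Y ω)) ⁻¹' S) ∂P :=
        lintegral_map (measurable_measure_prodMk_right hS) hY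
    _ ≤ ∫⁻ _, η ∂P := by
        refine lintegral_mono fun ω => ?_
        rw [Measure.map_apply hX (measurable_prodMk_right hS)]
        exact hη ω
    _ = η := by simp

/-- By Cramer's rule an entry is an adjugate entry divided by a determinant, both continuous. No
invertibility is required. -/
theorem measurable_resolventMatrix_entry {n : Type*} [Fintype n] [DecidableEq n] (z : ℂ) (i j : n) :
    Measurable fun c : n × n → ℂ => resolventMatrix (Matrix.of fun i j => c (i, j)) z i j := by
  have hcont : Continuous fun c : n × n → ℂ =>
      (Matrix.of fun i j => c (i, j)) - z • (1 : Matrix n n ℂ) := by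
    refine Continuous.sub ?_ continuous_const
    exact continuous_matrix fun i j => continuous_apply _
  have h1 := hcont.matrix_det.measurable
  have h2 := (hcont.matrix_adjugate.matrix_elem i j).measurable
  simp only [resolventMatrix, Matrix.inv_def, Ring.inverse_eq_inv', Matrix.smul_apply, smul_eq_mul]
  exact h1.inv.mul h2

theorem measurableSet_quadraticForm_deviation (N : ℕ) (z : ℂ) (v r : ℝ) :
    MeasurableSet {p : (Fin N → ℂ) × (Fin N × Fin N → ℂ) |
      r ≤ ‖star p.1 ⬝ᵥ resolventMatrix (Matrix.of fun i j => p.2 (i, j)) z *ᵥ p.1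
        - v * (resolventMatrix (Matrix.of fun i j => p.2 (i, j)) z).trace‖} := by
  have hR : ∀ i j : Fin N, Measurable fun p : (Fin N → ℂ) × (Fin N × Fin N → ℂ) =>
      resolventMatrix (Matrix.of fun i j => p.2 (i, j)) z i j := fun i j =>
    (measurable_resolventMatrix_entry z i j).comp measurable_snd
  have hx : ∀ i : Fin N, Measurable fun p : (Fin N → ℂ) × (Fin N × Fin N → ℂ) => p.1 i := fun i =>
    (measurable_pi_apply i).comp measurable_fst
  refine measurableSet_le measurable_const (Measurable.norm (Measurable.sub ?_ ?_))
  · simp only [dotProduct, mulVec, Pi.star_apply]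
    refine Finset.measurable_fun_sum _ fun i _ => (continuous_star.measurable.comp (hx i)).mul ?_
    exact Finset.measurable_fun_sum _ fun j _ => (hR i j).mul (hx j)
  · simp only [trace, diag_apply]
    exact (Finset.measurable_fun_sum _ fun i _ => hR i i).const_mul _

/-- Markov's inequality applied to the L¹ bound. The resolvent bound 1/Im z controls diagonal
entries and columns, so n₀ is uniform over all Hermitian C. -/
theorem measure_quadraticForm_resolvent_le {x : ℕ → Ω → ℂ} (hx : ∀ i, Measurable (x i))
    (hind : iIndepFun x P) (hident : ∀ i, IdentDistrib (x i) (x 0) P P) (hx2 : MemLp (x 0) 2 P)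
    (hx0 : ∫ ω, x 0 ω ∂P = 0) {v : ℝ} (hv : ∫ ω, ‖x 0 ω‖ ^ 2 ∂P = v) {z : ℂ} (hz : 0 < z.im)
    {ε η : ℝ} (hε : 0 < ε) (hη : 0 < η) :
    ∃ n₀ : ℕ, ∀ N ≥ n₀, ∀ C : Matrix (Fin N) (Fin N) ℂ, C.IsHermitian →
      P {ω | ε * N ≤ ‖star (fun j : Fin N => x j ω) ⬝ᵥ
        resolventMatrix C z *ᵥ (fun j : Fin N => x j ω) - v * (resolventMatrix C z).trace‖}
        ≤ ENNReal.ofReal η := by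
  obtain ⟨n₀, hn₀⟩ := exists_integral_norm_quadraticForm_le hx hind hident hx2 hx0 hv
    (K := z.im⁻¹) (ρ := ε * η) (by positivity) (by positivity)
  refine ⟨n₀ + 1, fun N hN C hC => ?_⟩
  set R := resolventMatrix C z with hR
  -- The concentration lemma uses coefficients indexed by ℕ, so the resolvent is extended by zero.
  set A : ℕ → ℕ → ℂ := fun i j => if h : i < N ∧ j < N then R ⟨i, h.1⟩ ⟨j, h.2⟩ else 0 with hA
  have hAR : ∀ i j : Fin N, A i j = R i j := fun i j => by simp [hA]
  have hcol : ∀ j : Fin N, ∑ i : Fin N, ‖R i j‖ ^ 2 ≤ (z.im⁻¹) ^ 2 :=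
    resolventMatrix_col_norm_sq_le hC hz
  have hdiag : ∀ i < N, ‖A i i‖ ≤ z.im⁻¹ := by
    intro i hi
    have h1 := hAR ⟨i, hi⟩ ⟨i, hi⟩
    simp only at h1
    rw [h1]
    have h2 := (Finset.single_le_sum (f := fun k => ‖R k ⟨i, hi⟩‖ ^ 2) (fun k _ => by positivity)
      (Finset.mem_univ ⟨i, hi⟩)).trans (hcol ⟨i, hi⟩)
    exact le_of_sq_le_sq h2 (by positivity)
  have hsum : ∑ i ∈ Finset.range N, ∑ j ∈ Finset.range N, ‖A i j‖ ^ 2 ≤ N * (z.im⁻¹) ^ 2 := by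
    rw [Finset.sum_comm, ← Fin.sum_univ_eq_sum_range]
    simp only [← Fin.sum_univ_eq_sum_range]
    simp only [hAR]
    calc _ ≤ ∑ _j : Fin N, (z.im⁻¹) ^ 2 := Finset.sum_le_sum fun j _ => hcol j
      _ = _ := by simp
  obtain ⟨hi, hle⟩ := hn₀ N (by omega) A hdiag hsum
  have hform : ∀ ω, ∑ i ∈ Finset.range N, ∑ j ∈ Finset.range N,
        star (x i ω) * A i j * x j ω - v * ∑ i ∈ Finset.range N, A i i
      = star (fun j : Fin N => x j ω) ⬝ᵥ R *ᵥ (fun j : Fin N => x j ω) - v * R.trace := by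
    intro ω
    rw [← Fin.sum_univ_eq_sum_range, ← Fin.sum_univ_eq_sum_range]
    simp only [← Fin.sum_univ_eq_sum_range]
    simp only [hAR, trace, diag_apply, dotProduct, mulVec, Pi.star_apply, Finset.mul_sum, mul_assoc]
  simp only [hform] at hi hle
  have hmarkov := mul_meas_ge_le_integral_of_nonneg
    (ae_of_all P fun ω => norm_nonneg (star (fun j : Fin N => x j ω) ⬝ᵥ
      R *ᵥ (fun j : Fin N => x j ω) - v * R.trace)) hi.norm (ε * N)
  have hN' : (0 : ℝ) < N := by exact_mod_cast (by omega : 0 < N)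
  rw [← ENNReal.ofReal_toReal (measure_ne_top P _)]
  apply ENNReal.ofReal_le_ofReal
  have h1 := hmarkov.trans hle
  have h2 : (ε * N) * P.real {ω | ε * N ≤ ‖star (fun j : Fin N => x j ω) ⬝ᵥ
      R *ᵥ (fun j : Fin N => x j ω) - v * R.trace‖} ≤ (ε * N) * η := by linarith
  exact le_of_mul_le_mul_left h2 (by positivity)

theorem star_column_dotProduct {x : ℕ → Ω → ℂ} {N : ℕ} (A : Matrix (Fin N) (Fin N) ℂ) (ω : Ω) :
    star (column x N ω) ⬝ᵥ A *ᵥ column x N ω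
      = (N : ℂ)⁻¹ * (star (fun j : Fin N => x j ω) ⬝ᵥ A *ᵥ (fun j : Fin N => x j ω)) := by
  have h : column x N ω = ((1 / Real.sqrt N : ℝ) : ℂ) • fun j : Fin N => x j ω := rfl
  rw [h, star_smul, mulVec_smul, smul_dotProduct, dotProduct_smul, smul_smul, smul_eq_mul]
  congr 1
  rw [← starRingEnd_apply, Complex.conj_ofReal, ← Complex.ofReal_mul, div_mul_div_comm,
    Real.mul_self_sqrt (Nat.cast_nonneg N)]
  simp

theorem tendstoInMeasure_quadraticForm_sub_trace {x : ℕ → Ω → ℂ} (hx : ∀ i, Measurable (x i))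
    (hind : iIndepFun x P) (hident : ∀ i, IdentDistrib (x i) (x 0) P P) (hx2 : MemLp (x 0) 2 P)
    (hx0 : ∫ ω, x 0 ω ∂P = 0) {v : ℝ} (hv : ∫ ω, ‖x 0 ω‖ ^ 2 ∂P = v)
    {C : (N : ℕ) → Ω → Matrix (Fin N) (Fin N) ℂ}
    (hCm : ∀ N, ∀ i j : Fin N, Measurable fun ω => C N ω i j) (hC : ∀ N ω, (C N ω).IsHermitian)
    (hxC : ∀ N, IndepFun (fun ω (j : Fin N) => x j ω)
      (fun ω (p : Fin N × Fin N) => C N ω p.1 p.2) P) {z : ℂ} (hz : 0 < z.im) :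
    TendstoInMeasure P (fun N ω => star (column x N ω) ⬝ᵥ
      resolventMatrix (C N ω) z *ᵥ column x N ω
        - v * ((N : ℂ)⁻¹ * (resolventMatrix (C N ω) z).trace)) atTop (fun _ => 0) := by
  rw [tendstoInMeasure_iff_norm]
  intro ε hε
  rw [ENNReal.tendsto_atTop_zero]
  intro η hη
  obtain ⟨η', hη', hηη⟩ : ∃ η' : ℝ, 0 < η' ∧ ENNReal.ofReal η' ≤ η := by
    obtain ⟨q, hq, hq'⟩ := ENNReal.lt_iff_exists_real_btwn.1 hη
    exact ⟨q, ENNReal.ofReal_pos.1 hq'.1, hq'.2.le⟩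
  obtain ⟨n₀, hn₀⟩ := measure_quadraticForm_resolvent_le hx hind hident hx2 hx0 hv hz hε hη'
  refine ⟨n₀ + 1, fun N hN => le_trans ?_ hηη⟩
  have hN' : (0 : ℝ) < N := by exact_mod_cast (by omega : 0 < N)
  -- Freeze C by independence; the bound for deterministic C is uniform, so it holds for the random
  -- one.
  have h := measure_le_of_indepFun (measurable_pi_iff.2 fun j : Fin N => hx j)
    (measurable_pi_iff.2 fun p : Fin N × Fin N => hCm N p.1 p.2) (hxC N)
    (measurableSet_quadraticForm_deviation N z v (ε * N)) (η := ENNReal.ofReal η')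
    (fun ω => hn₀ N (by omega) (C N ω) (hC N ω))
  refine le_trans (measure_mono fun ω hω => ?_) h
  simp only [Set.mem_ofPred_eq, sub_zero] at hω ⊢
  rw [star_column_dotProduct, mul_left_comm, ← mul_sub, norm_mul, norm_inv, Complex.norm_natCast,
    inv_mul_eq_div, le_div_iff₀ hN'] at hω
  exact hω

theorem integral_spectralMeasure {N : ℕ} {C : Matrix (Fin N) (Fin N) ℂ} (hC : C.IsHermitian)
    {E : Type*} [NormedAddCommGroup E] [NormedSpace ℝ E] [CompleteSpace E] (f : ℝ → E) :
    ∫ t, f t ∂(spectralMeasure hC) = (N : ℝ)⁻¹ • ∑ j, f (hC.eigenvalues j) := by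
  rw [spectralMeasure, integral_smul_measure, integral_finsetSum_measure]
  · simp
  · intro j _
    exact integrable_dirac (by simp)

theorem stieltjes_spectralMeasure {N : ℕ} {C : Matrix (Fin N) (Fin N) ℂ} (hC : C.IsHermitian)
    {z : ℂ} (hz : z.im ≠ 0) :
    stieltjes (spectralMeasure hC) z = (N : ℂ)⁻¹ * (resolventMatrix C z).trace := by
  rw [stieltjes, integral_spectralMeasure, trace_resolventMatrix hC hz, Complex.real_smul]
  simp

end Resolvents

/-! ### Convergence in probability -/

section Convergence

variable {Ω : Type*} {mΩ : MeasurableSpace Ω} {P : Measure Ω}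

theorem tendstoInMeasure_add {E : Type*} [SeminormedAddCommGroup E] {f g : ℕ → Ω → E}
    {f' g' : Ω → E}
    (hf : TendstoInMeasure P f atTop f') (hg : TendstoInMeasure P g atTop g') :
    TendstoInMeasure P (fun n ω => f n ω + g n ω) atTop (fun ω => f' ω + g' ω) := by
  rw [tendstoInMeasure_iff_norm] at hf hg ⊢
  intro ε hε
  have h := (hf (ε / 2) (by positivity)).add (hg (ε / 2) (by positivity))
  rw [add_zero] at h
  refine tendsto_of_tendsto_of_tendsto_of_le_of_le tendsto_const_nhds h (fun _ => zero_le) ?_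
  intro n
  refine (measure_mono fun ω hω => ?_).trans (measure_union_le _ _)
  simp only [Set.mem_ofPred_eq, Set.mem_union] at hω ⊢
  by_contra! hcon
  have h1 : f n ω + g n ω - (f' ω + g' ω) = (f n ω - f' ω) + (g n ω - g' ω) := by abel
  rw [h1] at hω
  have := norm_add_le (f n ω - f' ω) (g n ω - g' ω)
  linarith

theorem tendstoInMeasure_lipschitz_comp {E F : Type*} [SeminormedAddCommGroup E]
    [SeminormedAddCommGroup F] {f : ℕ → Ω → E} {f' : Ω → E} (hf : TendstoInMeasure P f atTop f')
    {φ : E → F} {K : ℝ} (hK : 0 < K) (hφ : ∀ x y, ‖φ x - φ y‖ ≤ K * ‖x - y‖) :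
    TendstoInMeasure P (fun n ω => φ (f n ω)) atTop (fun ω => φ (f' ω)) := by
  rw [tendstoInMeasure_iff_norm] at hf ⊢
  intro ε hε
  refine tendsto_of_tendsto_of_tendsto_of_le_of_le tendsto_const_nhds (hf (ε / K) (by positivity))
    (fun _ => zero_le) fun n => measure_mono fun ω hω => ?_
  simp only [Set.mem_ofPred_eq] at hω ⊢
  rw [div_le_iff₀' hK]
  exact hω.trans (hφ _ _)

theorem TendstoWeaklyInProbability.stieltjes {ν : ℕ → Ω → Measure ℝ} {μ : Measure ℝ}
    [IsFiniteMeasure μ] [∀ N ω, IsFiniteMeasure (ν N ω)]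
    (h : TendstoWeaklyInProbability P ν μ) {z : ℂ} (hz : 0 < z.im) :
    TendstoInMeasure P (fun N ω => stieltjes (ν N ω) z) atTop (fun _ => stieltjes μ z) := by
  have hcont := continuous_cauchyKernel hz.ne'
  have hb := norm_cauchyKernel_le hz
  have h1 := h (BoundedContinuousFunction.ofNormedAddCommGroup
    (fun t : ℝ => (1 / ((t : ℂ) - z)).re) (Complex.continuous_re.comp hcont) z.im⁻¹
    fun t => (Complex.abs_re_le_norm _).trans (hb t))
  have h2 := h (BoundedContinuousFunction.ofNormedAddCommGroup
    (fun t : ℝ => (1 / ((t : ℂ) - z)).im) (Complex.continuous_im.comp hcont) z.im⁻¹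
    fun t => (Complex.abs_im_le_norm _).trans (hb t))
  have h1' := tendstoInMeasure_lipschitz_comp h1 (φ := fun r : ℝ => (r : ℂ)) one_pos
    fun x y => by rw [← Complex.ofReal_sub, Complex.norm_real, one_mul]
  have h2' := tendstoInMeasure_lipschitz_comp h2 (φ := fun r : ℝ => (r : ℂ) * Complex.I) one_pos
    fun x y => by
      rw [← sub_mul, ← Complex.ofReal_sub, norm_mul, Complex.norm_I, mul_one, Complex.norm_real,
        one_mul]
  have hre : ∀ ρ : Measure ℝ, IsFiniteMeasure ρ →
      ((∫ t : ℝ, (1 / ((t : ℂ) - z)).re ∂ρ : ℝ) : ℂ)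
        + (∫ t : ℝ, (1 / ((t : ℂ) - z)).im ∂ρ : ℝ) * Complex.I = HSelfadjoint.stieltjes ρ z := by
    intro ρ _
    have := integral_re_add_im (𝕜 := ℂ) (integrable_cauchyKernel (σ := ρ) hz)
    exact this
  have h3 := tendstoInMeasure_add h1' h2'
  simp only [BoundedContinuousFunction.coe_ofNormedAddCommGroup] at h3
  simpa only [hre _ inferInstance] using h3

end Convergence

/-! ### Limit of the transfer functions and location of the eigenvalues -/

section Main

open Matrix

variable {Ω : Type*} {mΩ : MeasurableSpace Ω} {P : Measure Ω}

instance isFiniteMeasure_spectralMeasure {N : ℕ} {C : Matrix (Fin N) (Fin N) ℂ}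
    (hC : C.IsHermitian) : IsFiniteMeasure (spectralMeasure hC) := by
  rcases Nat.eq_zero_or_pos N with rfl | hN
  · have : spectralMeasure hC = 0 := by simp [spectralMeasure]
    rw [this]; infer_instance
  · refine Measure.smul_finite _ (ENNReal.inv_ne_top.2 ?_)
    exact_mod_cast hN.ne'

/-- Absorbs s² into the measure, so that Q₀(z) = -z + σ̂(z) for a single finite measure σ. -/
theorem stieltjes_toNNReal_smul (μ : Measure ℝ) (s : ℝ) (z : ℂ) :
    stieltjes ((s ^ 2).toNNReal • μ) z = (s : ℂ) ^ 2 * stieltjes μ z := by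
  rw [stieltjes, integral_smul_nnreal_measure, NNReal.smul_def, Real.coe_toNNReal _ (sq_nonneg s),
    Complex.real_smul, stieltjes]
  push_cast
  rfl

theorem tendstoInMeasure_transferFunction [IsProbabilityMeasure P] {a : ℕ → Ω → ℝ}
    {x : ℕ → Ω → ℂ} {C : (N : ℕ) → Ω → Matrix (Fin N) (Fin N) ℂ} {s : ℝ} {μ₀ : Measure ℝ}
    [IsFiniteMeasure μ₀] (hx : ∀ j, Measurable (x j))
    (hCm : ∀ N, ∀ i j : Fin N, Measurable fun ω => C N ω i j) (hC : ∀ N ω, (C N ω).IsHermitian)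
    (ha : TendstoInMeasure P a atTop (fun _ => (0 : ℝ))) (hind : iIndepFun x P)
    (hident : ∀ j, IdentDistrib (x j) (x 0) P P)
    (hxC : ∀ N, IndepFun (fun ω (j : Fin N) => x j ω)
      (fun ω (p : Fin N × Fin N) => C N ω p.1 p.2) P)
    (hx2 : MemLp (x 0) 2 P) (hx0 : ∫ ω, x 0 ω ∂P = 0) (hs : ∫ ω, ‖x 0 ω‖ ^ 2 ∂P = s ^ 2)
    (hlim : TendstoWeaklyInProbability P (fun N ω => spectralMeasure (hC N ω)) μ₀) {z : ℂ}
    (hz : 0 < z.im) :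
    TendstoInMeasure P (fun N ω => transferFunction (a N ω) (column x N ω) (C N ω) z) atTop
      (fun _ => stieltjes ((s ^ 2).toNNReal • μ₀) z) := by
  have h1 := tendstoInMeasure_quadraticForm_sub_trace hx hind hident hx2 hx0 hs hCm hC hxC hz
  have h2 := tendstoInMeasure_lipschitz_comp (hlim.stieltjes hz)
    -- The added 1 keeps the Lipschitz constant positive when s = 0.
    (φ := fun w : ℂ => (s : ℂ) ^ 2 * w) (K := s ^ 2 + 1) (by positivity) fun u w => by
      rw [← mul_sub, norm_mul, ← Complex.ofReal_pow, Complex.norm_real,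
        Real.norm_of_nonneg (sq_nonneg s)]
      nlinarith [norm_nonneg (u - w)]
  have h3 := tendstoInMeasure_lipschitz_comp ha (φ := fun r : ℝ => (r : ℂ)) one_pos
    fun u w => by rw [← Complex.ofReal_sub, Complex.norm_real, one_mul]
  have h4 := tendstoInMeasure_add h3 (tendstoInMeasure_add h1 h2)
  simp only [stieltjes_spectralMeasure (hC _ _) hz.ne', ← stieltjes_toNNReal_smul,
    Complex.ofReal_zero, zero_add] at h4
  refine h4.congr_left fun N => ae_of_all _ fun ω => ?_
  simp only [transferFunction]
  push_cast
  ring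

/-- If the transfer functions converge in probability on the upper half-plane to the Stieltjes
transform of `σ`, then the eigenvalues of nonpositive type eventually lie, with high probability, in
any open set containing the points satisfying Julia's inequality for the limit. -/
theorem tendsto_measure_eigenvalue_notMem {a : ℕ → Ω → ℝ}
    {b : (N : ℕ) → Ω → Fin N → ℂ} {C : (N : ℕ) → Ω → Matrix (Fin N) (Fin N) ℂ}
    (hC : ∀ N ω, (C N ω).IsHermitian) {σ : Measure ℝ} [IsFiniteMeasure σ]
    (hlim : ∀ z : ℂ, 0 < z.im → TendstoInMeasure P
      (fun N ω => transferFunction (a N ω) (b N ω) (C N ω) z) atTop (fun _ => stieltjes σ z))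
    {β : ℕ → Ω → ℂ} (hβ : ∀ N ω, IsEigenvalueOfNonposType (signMatrix N)
      (blockMatrix (a N ω) (b N ω) (C N ω)) (β N ω)) {U : Set ℂ} (hU : IsOpen U)
    (h : ∀ w : ℂ, 0 ≤ w.im → (∀ z : ℂ, 0 < z.im → JuliaInequality (stieltjes σ) w z) → w ∈ U) :
    Tendsto (fun N => P {ω | β N ω ∉ U}) atTop (𝓝 0) := by
  obtain ⟨Z, hZ, δ, hδ, hmain⟩ := exists_finset_juliaInequality hU h
  have hsum : Tendsto (fun N => ∑ z ∈ Z,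
      P {ω | δ ≤ ‖transferFunction (a N ω) (b N ω) (C N ω) z - stieltjes σ z‖}) atTop (𝓝 0) := by
    have := tendsto_finsetSum Z fun z hz => tendstoInMeasure_iff_norm.1 (hlim z (hZ z hz)) δ hδ
    simpa using this
  refine tendsto_of_tendsto_of_tendsto_of_le_of_le tendsto_const_nhds hsum (fun _ => zero_le) ?_
  intro N
  refine (measure_mono fun ω hω => ?_).trans (measure_biUnion_finset_le Z _)
  -- If F_N is close to the limit at every z in Z, Julia's inequality for F_N puts β_N in U.
  by_contra hcon
  simp only [Set.mem_iUnion, Set.mem_ofPred_eq, not_exists, not_le] at hcon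
  exact hω (hmain (transferFunction (a N ω) (b N ω) (C N ω)) (β N ω) (hβ N ω).1 hcon
    fun z hz => (hβ N ω).juliaInequality (hC N ω) (hZ z hz))

end Main

end HSelfadjoint

/-! ### The three assertions -/

theorem theorem1 {Ω : Type*} [MeasurableSpace Ω] (P : Measure Ω) [IsProbabilityMeasure P]
    (a : ℕ → Ω → ℝ) (x : ℕ → Ω → ℂ) (C : (N : ℕ) → Ω → Matrix (Fin N) (Fin N) ℂ)
    (s : ℝ) (μ₀ : Measure ℝ) [IsFiniteMeasure μ₀]
    (ha_meas : ∀ N, Measurable (a N))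
    (hx_meas : ∀ j, Measurable (x j))
    (hC_meas : ∀ N, ∀ i j : Fin N, Measurable fun ω => C N ω i j)
    (hC : ∀ N ω, (C N ω).IsHermitian)
    -- assumptions on `a_N`
    (ha_indep_b : ∀ N, IndepFun (a N) (HSelfadjoint.column x N) P)
    (ha_indep_C : ∀ N, IndepFun (a N) (fun ω (p : Fin N × Fin N) => C N ω p.1 p.2) P)
    (ha_lim : TendstoInMeasure P a atTop (fun _ => (0 : ℝ)))
    -- assumptions on the column `b_N`
    (hx_indep : iIndepFun x P)
    (hx_ident : ∀ j, IdentDistrib (x j) (x 0) P P)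
    (hx_indep_C : ∀ N, IndepFun (fun ω (j : Fin N) => x j ω)
      (fun ω (p : Fin N × Fin N) => C N ω p.1 p.2) P)
    (hx_L2 : MemLp (x 0) 2 P)
    (hx_mean : ∫ ω, x 0 ω ∂P = 0)
    (hx_var : ∫ ω, ‖x 0 ω‖ ^ 2 ∂P = s ^ 2)
    -- assumption on `C_N`
    (hC_lim : HSelfadjoint.TendstoWeaklyInProbability P
      (fun N ω => HSelfadjoint.spectralMeasure (hC N ω)) μ₀) :
    (∀ N ω, ∃! β : ℂ, HSelfadjoint.IsEigenvalueOfNonposType (HSelfadjoint.signMatrix N)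
      (HSelfadjoint.blockMatrix (a N ω) (HSelfadjoint.column x N ω) (C N ω)) β) ∧
    (∃! β₀ : ℂ, HSelfadjoint.IsGZNT
      (fun z => -z + (s : ℂ) ^ 2 * HSelfadjoint.stieltjes μ₀ z) β₀) ∧
    ∀ (β : ℕ → Ω → ℂ) (β₀ : ℂ),
      (∀ N ω, HSelfadjoint.IsEigenvalueOfNonposType (HSelfadjoint.signMatrix N)
        (HSelfadjoint.blockMatrix (a N ω) (HSelfadjoint.column x N ω) (C N ω)) (β N ω)) →
      HSelfadjoint.IsGZNT (fun z => -z + (s : ℂ) ^ 2 * HSelfadjoint.stieltjes μ₀ z) β₀ →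
      TendstoInMeasure P β atTop (fun _ => β₀) := by
  have hdet : ∀ N ω, ∃! β : ℂ, HSelfadjoint.IsEigenvalueOfNonposType (HSelfadjoint.signMatrix N)
      (HSelfadjoint.blockMatrix (a N ω) (HSelfadjoint.column x N ω) (C N ω)) β := by
    intro N ω
    obtain ⟨β, hβ⟩ := HSelfadjoint.exists_isEigenvalueOfNonposType (a N ω)
      (HSelfadjoint.column x N ω) (C N ω) (hC N ω)
    exact ⟨β, hβ, fun β' hβ' => hβ'.unique (hC N ω) hβ⟩
  set σ : Measure ℝ := (s ^ 2).toNNReal • μ₀ with hσ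
  have hlim : ∀ z : ℂ, 0 < z.im → TendstoInMeasure P (fun N ω =>
      HSelfadjoint.transferFunction (a N ω) (HSelfadjoint.column x N ω) (C N ω) z) atTop
      (fun _ => HSelfadjoint.stieltjes σ z) := fun z hz =>
    HSelfadjoint.tendstoInMeasure_transferFunction hx_meas hC_meas hC ha_lim hx_indep hx_ident
      hx_indep_C hx_L2 hx_mean hx_var hC_lim hz
  simp only [← HSelfadjoint.stieltjes_toNNReal_smul]
  rw [← hσ]
  have huniq : ∀ β₁ β₂ : ℂ, HSelfadjoint.IsGZNT (fun z => -z + HSelfadjoint.stieltjes σ z) β₁ →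
      HSelfadjoint.IsGZNT (fun z => -z + HSelfadjoint.stieltjes σ z) β₂ → β₁ = β₂ := by
    intro β₁ β₂ h₁ h₂
    obtain ⟨h₁, him₁⟩ := h₁.isAttractingFixedPoint
    obtain ⟨h₂, him₂⟩ := h₂.isAttractingFixedPoint
    exact h₁.unique h₂ him₁ him₂
  refine ⟨hdet, ?_, ?_⟩
  · choose β hβ _ using hdet
    obtain ⟨β₀, him, hβ₀⟩ : ∃ β₀ : ℂ, 0 ≤ β₀.im ∧
        ∀ z : ℂ, 0 < z.im → HSelfadjoint.JuliaInequality (HSelfadjoint.stieltjes σ) β₀ z := by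
      -- Without a Julia point the empty set is an admissible neighbourhood, and then the
      -- probability of the whole space would tend to 0.
      by_contra! hcon
      have h := HSelfadjoint.tendsto_measure_eigenvalue_notMem hC hlim hβ isOpen_empty
        fun w hw hJ => by
          obtain ⟨z, hz, hz'⟩ := hcon w hw
          exact hz' (hJ z hz)
      simp at h
    exact ⟨β₀, HSelfadjoint.isGZNT_of_juliaInequality him hβ₀, fun β' hβ' =>
      huniq _ _ hβ' (HSelfadjoint.isGZNT_of_juliaInequality him hβ₀)⟩
  · intro β β₀ hβ hβ₀
    rw [tendstoInMeasure_iff_norm]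
    intro ε hε
    -- Every Julia point of the limit is a GZNT, hence equals β₀, so any ball around β₀ is
    -- admissible.
    have h := HSelfadjoint.tendsto_measure_eigenvalue_notMem hC hlim hβ
      (Metric.isOpen_ball (x := β₀) (ε := ε)) fun w hw hJ => by
        rw [huniq _ _ (HSelfadjoint.isGZNT_of_juliaInequality hw hJ) hβ₀]
        exact Metric.mem_ball_self hε
    simpa [dist_eq_norm] using h
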